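/- There is a universal constant $C>0$ such that the following holds. Let $d\ge 2$, let $\mathcal H_d=\bigotimes_{i=1}^d\mathbb R^{n_i}$ carry the Euclidean norm, let $n=\max\{n_1,\dots,n_d\}$, let $\delta,\varepsilon\in(0,1)$, and let $\mathcal A:\mathcal H_d\to\mathbb R^m$ be a Gaussian measurement map, i.e. $$(\mathcal A\mathbf u)_\ell=\sum_{\mu_1=1}^{n_1}\cdots\sum_{\mu_d=1}^{n_d}\mathbf a(\ell,\mu_1,\dots,\mu_d)\,\mathbf u(\mu_1,\dots,\mu_d),\qquad \ell=1,\dots,m,$$ where the entries of $\mathbf a$ are independent normal random variables with mean $0$ and variance $1/m$. For $\alpha\subset\{1,\dots,d\}$ let $\mathbf U^\alpha$ be the matricisation of $\mathbf u\in\mathcal H_d$ whose row index is $(\mu_i)_{i\in\alpha}$ and whose column index is $(\mu_i)_{i\notin\alpha}$. In the HOSVD (Tucker) format the multilinear rank of $\mathbf u$ is the tuple $(\operatorname{rank}\mathbf U^{\{i\}})_{i=1}^{d}$; in the TT format it is the tuple $(\operatorname{rank}\mathbf U^{\{1,\dots,i\}})_{i=1}^{d-1}$. For a tuple $\mathbf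 r=(r_i)_i$ of non-negative integers let $\mathcal M_{\mathbf r}$ be the set of tensors of multilinear rank $\mathbf r$ in the respective format, let $r=\max_i r_i$, and let $\delta_{\mathbf r}$ be the smallest number $\delta_{\mathbf r}\ge 0$ with $$(1-\delta_{\mathbf r})\|\mathbf u\|^2\le\|\mathcal A\mathbf u\|^2\le(1+\delta_{\mathbf r})\|\mathbf u\|^2\quad\text{for all }\mathbf u\in\mathcal M_{\mathbf r}.$$ Then $\delta_{\mathbf r}\le\delta$ with probability at least $1-\varepsilon$, provided that - (HOSVD format) $m\ge C\delta^{-2}\max\{(r^d+dnr)\log d,\ \log(\varepsilon^{-1})\}$; - (TT format) $m\ge C\delta^{-2}\max\{dnr^2\log(dr),\ \log(\varepsilon^{-1})\}$. -/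

import Mathlib

open MeasureTheory ProbabilityTheory
open scoped NNReal ENNReal

/-- The multi-indices `(μ₁, …, μ_d)` with `μ_i` ranging over `n_i` values. -/
abbrev MultiIndex {d : ℕ} (n : Fin d → ℕ) : Type := (i : Fin d) → Fin (n i)

/-- The tensor space `ℝ^{n₁} ⊗ ⋯ ⊗ ℝ^{n_d}`, in coordinates, with its Euclidean norm. -/
abbrev TensorSpace {d : ℕ} (n : Fin d → ℕ) : Type := EuclideanSpace ℝ (MultiIndex n)

/-- The matricisation `U^α` of `u`: the indices `μ_i` with `i ∈ α` form the row index, the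
remaining ones the column index. -/
def matricisation {d : ℕ} {n : Fin d → ℕ} (u : TensorSpace n) (α : Finset (Fin d)) :
    Matrix ((i : {i // i ∈ α}) → Fin (n i)) ((i : {i // i ∉ α}) → Fin (n i)) ℝ :=
  Matrix.of fun I J => u fun i => if h : i ∈ α then I ⟨i, h⟩ else J ⟨i, h⟩

/-- A tensor format is given by the family `node` of sets of modes along which tensors are
matricised. `rankManifold node n r` is the set `M_r` of tensors whose multi-linear rank is the
tuple `r`. -/
def rankManifold {d : ℕ} {ι : Type} (node : ι → Finset (Fin d)) (n : Fin d → ℕ) (r : ι → ℕ) :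
    Set (TensorSpace n) :=
  {u | ∀ j, (matricisation u (node j)).rank = r j}

/-- HOSVD (Tucker) format: the nodes are the leaves `{1}, …, {d}`. -/
def hosvdNode (d : ℕ) (i : Fin d) : Finset (Fin d) := {i}

/-- TT format: the nodes are `{1}, {1, 2}, …, {1, …, d - 1}`. -/
def ttNode (d : ℕ) (j : Fin (d - 1)) : Finset (Fin d) :=
  Finset.univ.filter fun i => (i : ℕ) ≤ (j : ℕ)

/-- The numbers `δ` that are admissible in the tensor restricted isometry condition for `A` on
`M_r`. For a nonzero tensor in `M_r` the two inequalities force `0 ≤ δ`; the condition `0 ≤ δ`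
only matters if `M_r` contains no nonzero tensor. -/
def ricSet {d m : ℕ} {ι : Type} (node : ι → Finset (Fin d)) {n : Fin d → ℕ} (r : ι → ℕ)
    (A : TensorSpace n →ₗ[ℝ] EuclideanSpace ℝ (Fin m)) : Set ℝ :=
  {δ | 0 ≤ δ ∧ ∀ u ∈ rankManifold node n r,
    (1 - δ) * ‖u‖ ^ 2 ≤ ‖A u‖ ^ 2 ∧ ‖A u‖ ^ 2 ≤ (1 + δ) * ‖u‖ ^ 2}

/-- The tensor restricted isometry constant `δ_r` of `A`: the smallest admissible number. -/
noncomputable def tric {d m : ℕ} {ι : Type} (node : ι → Finset (Fin d)) {n : Fin d → ℕ}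
    (r : ι → ℕ) (A : TensorSpace n →ₗ[ℝ] EuclideanSpace ℝ (Fin m)) : ℝ :=
  sInf (ricSet node r A)

/-- The infimum in the definition of `δ_r` is a minimum. -/
theorem tric_isLeast {d m : ℕ} {ι : Type} (node : ι → Finset (Fin d)) {n : Fin d → ℕ}
    (r : ι → ℕ) (A : TensorSpace n →ₗ[ℝ] EuclideanSpace ℝ (Fin m)) :
    IsLeast (ricSet node r A) (tric node r A) := by
  have hbdd : BddBelow (ricSet node r A) := ⟨0, fun δ hδ => hδ.1⟩
  have hclosed : IsClosed (ricSet node r A) := by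
    have h : ricSet node r A = Set.Ici 0 ∩ ⋂ u ∈ rankManifold node n r,
        ({δ : ℝ | (1 - δ) * ‖u‖ ^ 2 ≤ ‖A u‖ ^ 2} ∩ {δ : ℝ | ‖A u‖ ^ 2 ≤ (1 + δ) * ‖u‖ ^ 2}) := by
      ext δ
      simp [ricSet]
    rw [h]
    refine isClosed_Ici.inter (isClosed_biInter fun u _ => IsClosed.inter ?_ ?_)
    · exact isClosed_le (by fun_prop) (by fun_prop)
    · exact isClosed_le (by fun_prop) (by fun_prop)
  have hne : (ricSet node r A).Nonempty := by
    set K : ℝ := ‖LinearMap.toContinuousLinearMap A‖ with hK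
    have hK0 : 0 ≤ K := norm_nonneg _
    refine ⟨1 + K ^ 2, by positivity, fun u _ => ?_⟩
    have h1 : ‖A u‖ ≤ K * ‖u‖ := (LinearMap.toContinuousLinearMap A).le_opNorm u
    have h2 : ‖A u‖ ^ 2 ≤ (K * ‖u‖) ^ 2 := pow_le_pow_left₀ (norm_nonneg _) h1 2
    constructor
    · nlinarith [sq_nonneg ‖A u‖, mul_nonneg (sq_nonneg K) (sq_nonneg ‖u‖)]
    · nlinarith [sq_nonneg ‖u‖]
  exact ⟨hclosed.csInf_mem hne hbdd, fun δ hδ => csInf_le hbdd hδ⟩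

/-- The linear measurement map with coefficient tensor `a`:
`(A u)_ℓ = ∑_μ a(ℓ, μ) u(μ)`. -/
noncomputable def measurementMap {d m : ℕ} {n : Fin d → ℕ} (a : Fin m × MultiIndex n → ℝ) :
    TensorSpace n →ₗ[ℝ] EuclideanSpace ℝ (Fin m) where
  toFun u := WithLp.toLp 2 fun l => ∑ μ, a (l, μ) * u μ
  map_add' u v := by
    ext l
    simp [mul_add, Finset.sum_add_distrib]
  map_smul' c u := by
    ext l
    simp [Finset.mul_sum, mul_left_comm]

/-- `a` is the coefficient tensor of a Gaussian measurement map: its entries are independent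
normal random variables with mean `0` and variance `1 / m`. -/
structure IsGaussianMeasurement {Ω : Type*} [MeasurableSpace Ω] (P : Measure Ω) {d m : ℕ}
    {n : Fin d → ℕ} (a : Fin m × MultiIndex n → Ω → ℝ) : Prop where
  hasLaw : ∀ k, HasLaw (a k) (gaussianReal 0 (1 / (m : ℝ≥0))) P
  indep : iIndepFun a P

/-! Both formats are treated alike. After normalisation, every tensor of rank at most `r` is `T p`,
where `T` is a multilinear map with `‖T p‖ ≤ ∏ ‖p k‖` and `p` lies in the unit ball of a product of
`K ≤ d + 1` operator spaces of total dimension at most `D`. Here `D = r ^ d + d n r` for Tucker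
(contractive factors and a core) and `D = d n r ^ 2` for tensor trains (contractive cores); see
`exists_tuckerMultilinear_eq` and `exists_trainMultilinear_eq`.

A `1 / (4 K)`-net `N` of that ball has at most `(1 + 8 K) ^ D` points. Let `b` be the symmetric
bilinear form with `b x x = ‖A x‖ ^ 2 - ‖x‖ ^ 2`. If `A` is nearly isometric at the points `T p ± T
q` with `p, q ∈ N`, polarisation bounds `b` on all pairs from `T N`. Let `Δ` be the supremum of `|b
(T q) (T p)|` over the whole ball, `p` and `q` varying independently. With `q` fixed, `p ↦ b (T q)
(T p)` is multilinear of norm at most `Δ`, so moving `p` to the net costs at most `Δ / 4`; likewise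
for `q`. Hence `Δ ≤ s + Δ / 2`, i.e. `Δ ≤ 2 s` (`exists_finset_isometry_test`). The test points do
not depend on `A`.

At one fixed point a chi-square tail bound gives failure probability at most `2 exp (-m s ^ 2 /
16)`. A union bound with `s = δ / 2` leaves `4 (1 + 8 K) ^ (2 D) exp (-m δ ^ 2 / 64)`, and since `K
≤ d + 1` this is at most `ε` once `m δ ^ 2` dominates `D log d` and `log ε⁻¹`. -/

/-! ### Exponential moments of a centred squared Gaussian -/

theorem integral_exp_mul_sq_sub_one_gaussianReal {t : ℝ} (ht : t < 1 / 2) :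
    ∫ x, Real.exp (t * (x ^ 2 - 1)) ∂(gaussianReal 0 1)
      = Real.exp (-t) * (√(1 - 2 * t))⁻¹ := by
  rw [integral_gaussianReal_eq_integral_smul one_ne_zero]
  have h : ∀ x : ℝ, gaussianPDFReal 0 1 x • Real.exp (t * (x ^ 2 - 1))
      = (Real.exp (-t) * (√(2 * Real.pi))⁻¹) * Real.exp (-(1 / 2 - t) * x ^ 2) := fun x => by
    simp only [gaussianPDFReal, NNReal.coe_one, mul_one, sub_zero, smul_eq_mul]
    have : Real.exp (-x ^ 2 / 2) * Real.exp (t * (x ^ 2 - 1))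
        = Real.exp (-t) * Real.exp (-(1 / 2 - t) * x ^ 2) := by
      rw [← Real.exp_add, ← Real.exp_add]
      ring_nf
    linear_combination (√(2 * Real.pi))⁻¹ * this
  simp_rw [h]
  rw [integral_const_mul, integral_gaussian, mul_assoc]
  congr 1
  have h2 : Real.pi / (1 / 2 - t) = (2 * Real.pi) * (1 - 2 * t)⁻¹ := by
    have : (1 : ℝ) - 2 * t ≠ 0 := by linarith
    have : (1 : ℝ) / 2 - t ≠ 0 := by linarith
    field_simp
  have h3 : √(2 * Real.pi) ≠ 0 := by positivity
  rw [h2, Real.sqrt_mul (x := 2 * Real.pi) (by positivity), Real.sqrt_inv,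
    inv_mul_cancel_left₀ h3]

theorem integrable_exp_mul_sq_sub_one_gaussianReal {t : ℝ} (ht : t < 1 / 2) :
    Integrable (fun x => Real.exp (t * (x ^ 2 - 1))) (gaussianReal 0 1) := by
  by_contra h
  have h1 := integral_exp_mul_sq_sub_one_gaussianReal ht
  -- A non-integrable function has integral `0` by convention, which contradicts the positive closed
  -- form.
  rw [integral_undef h] at h1
  have : 0 < √(1 - 2 * t) := Real.sqrt_pos.2 (by linarith)
  have : 0 < Real.exp (-t) * (√(1 - 2 * t))⁻¹ := by positivity
  linarith

theorem integral_exp_mul_sq_sub_one_gaussianReal_le {t : ℝ} (ht : |t| ≤ 1 / 4) :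
    ∫ x, Real.exp (t * (x ^ 2 - 1)) ∂(gaussianReal 0 1) ≤ Real.exp (4 * t ^ 2) := by
  have ht' := abs_le.1 ht
  rw [integral_exp_mul_sq_sub_one_gaussianReal (by linarith)]
  have hpos : 0 < 1 - 2 * t := by linarith
  have hx : |2 * t| ≤ 1 / 2 := by rw [abs_mul, abs_two]; linarith
  -- First-order expansion `log (1 - 2 t) ≥ -2 t - 8 t ^ 2`; the linear term cancels the factor `exp
  -- (-t)`.
  have hlog := Real.abs_log_sub_add_sum_range_le (x := 2 * t) (by linarith) 1
  simp only [Finset.sum_range_one, zero_add, pow_one, Nat.cast_zero, div_one] at hlog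
  have h8 : |2 * t| ^ (1 + 1) / (1 - |2 * t|) ≤ 8 * t ^ 2 := by
    rw [div_le_iff₀ (by linarith), one_add_one_eq_two, sq_abs]
    nlinarith [sq_nonneg t]
  have h1 := (abs_le.1 (hlog.trans h8)).1
  rw [← Real.exp_log (inv_pos.2 (Real.sqrt_pos.2 hpos)), ← Real.exp_add, Real.exp_le_exp,
    Real.log_inv, Real.log_sqrt hpos.le]
  linarith

/-! ### Concentration of `‖A z‖ ^ 2` for one fixed tensor -/

section Concentration

variable {Ω : Type*} [MeasurableSpace Ω] {P : Measure Ω} [IsProbabilityMeasure P] {m : ℕ}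

/-- One-sided Chernoff bound for a signed, centred chi-square variable. -/
theorem measureReal_sum_sq_sub_one_ge_le {h : Fin m → Ω → ℝ}
    (hlaw : ∀ l, HasLaw (h l) (gaussianReal 0 1) P) (hind : iIndepFun h P)
    {s σ : ℝ} (hs0 : 0 ≤ s) (hs1 : s ≤ 1) (hσ : |σ| = 1) :
    P.real {ω | (m : ℝ) * s ≤ ∑ l, σ * (h l ω ^ 2 - 1)} ≤ Real.exp (-(m * s ^ 2 / 16)) := by
  set Y : Fin m → Ω → ℝ := fun l ω => σ * (h l ω ^ 2 - 1) with hY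
  have hmeas : ∀ l, AEMeasurable (Y l) P := fun l =>
    (((hlaw l).aemeasurable.pow_const 2).sub_const 1).const_mul σ
  have hYind : iIndepFun Y P :=
    hind.comp (fun _ x => σ * (x ^ 2 - 1)) (fun _ => by fun_prop)
  have hσ2 : σ ^ 2 = 1 := by rw [← sq_abs, hσ, one_pow]
  -- The Chernoff parameter `s / 8` minimises `-t s + 4 t ^ 2`, with value `-s ^ 2 / 16`.
  have ht : |s / 8 * σ| ≤ 1 / 4 := by
    rw [abs_mul, hσ, abs_of_nonneg (by positivity)]; linarith
  have ht' : s / 8 * σ < 1 / 2 := by linarith [(abs_le.1 ht).2]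
  have hfun : ∀ l, (fun ω => Real.exp (s / 8 * Y l ω))
      = (fun x => Real.exp (s / 8 * σ * (x ^ 2 - 1))) ∘ h l := fun l => by
    ext ω; simp [hY, mul_assoc]
  have hint : ∀ l, Integrable (fun ω => Real.exp (s / 8 * Y l ω)) P := fun l => by
    rw [hfun]
    refine Integrable.comp_aemeasurable ?_ (hlaw l).aemeasurable
    rw [(hlaw l).map_eq]
    exact integrable_exp_mul_sq_sub_one_gaussianReal ht'
  have hmgf : ∀ l, mgf (Y l) P (s / 8) ≤ Real.exp (s ^ 2 / 16) := fun l => by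
    rw [mgf, hfun, (hlaw l).integral_comp (by fun_prop)]
    refine (integral_exp_mul_sq_sub_one_gaussianReal_le ht).trans (le_of_eq ?_)
    rw [mul_pow, hσ2]; ring_nf
  have hintsum : Integrable (fun ω => Real.exp (s / 8 * (∑ l, Y l) ω)) P := by
    by_contra hni
    have h0 : mgf (∑ l, Y l) P (s / 8) = 0 := integral_undef hni
    rw [hYind.mgf_sum₀ hmeas] at h0
    exact (Finset.prod_pos fun l _ => mgf_pos (hint l)).ne' h0
  have hch := measure_ge_le_exp_mul_mgf (μ := P) (X := ∑ l, Y l) (t := s / 8) ((m : ℝ) * s)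
    (by positivity) hintsum
  rw [hYind.mgf_sum₀ hmeas] at hch
  have hprod : ∏ l, mgf (Y l) P (s / 8) ≤ Real.exp (s ^ 2 / 16) ^ m := by
    refine (Finset.prod_le_prod (fun l _ => mgf_nonneg) (fun l _ => hmgf l)).trans ?_
    simp
  have heq : {ω | (m : ℝ) * s ≤ ∑ l, σ * (h l ω ^ 2 - 1)}
      = {ω | (m : ℝ) * s ≤ (∑ l, Y l) ω} := by
    ext ω; simp [hY]
  rw [heq]
  refine hch.trans ((mul_le_mul_of_nonneg_left hprod (Real.exp_pos _).le).trans (le_of_eq ?_))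
  rw [← Real.exp_nat_mul, ← Real.exp_add]
  ring_nf

theorem measureReal_abs_sum_sq_sub_one_ge_le {h : Fin m → Ω → ℝ}
    (hlaw : ∀ l, HasLaw (h l) (gaussianReal 0 1) P) (hind : iIndepFun h P)
    {s : ℝ} (hs0 : 0 ≤ s) (hs1 : s ≤ 1) :
    P.real {ω | (m : ℝ) * s ≤ |∑ l, (h l ω ^ 2 - 1)|} ≤ 2 * Real.exp (-(m * s ^ 2 / 16)) := by
  have h1 := measureReal_sum_sq_sub_one_ge_le hlaw hind hs0 hs1 (σ := 1) (by simp)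
  have h2 := measureReal_sum_sq_sub_one_ge_le hlaw hind hs0 hs1 (σ := -1) (by simp)
  have hsub : {ω | (m : ℝ) * s ≤ |∑ l, (h l ω ^ 2 - 1)|} ⊆
      {ω | (m : ℝ) * s ≤ ∑ l, 1 * (h l ω ^ 2 - 1)} ∪
        {ω | (m : ℝ) * s ≤ ∑ l, -1 * (h l ω ^ 2 - 1)} := by
    intro ω hω
    simp only [Set.mem_union, Set.mem_ofPred_eq, one_mul, neg_one_mul, Finset.sum_neg_distrib]
      at hω ⊢
    exact le_abs.1 hω
  refine (measureReal_mono hsub).trans ((measureReal_union_le _ _).trans ?_)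
  linarith

/-- Linear forms with orthonormal coefficients in i.i.d. centred Gaussian variables are i.i.d. -/
theorem hasLaw_and_iIndepFun_of_orthonormal {κ : Type*} [Fintype κ] {X : κ → Ω → ℝ} {v : ℝ≥0}
    (hlaw : ∀ k, HasLaw (X k) (gaussianReal 0 v) P) (hind : iIndepFun X P) {c : Fin m → κ → ℝ}
    (hc : ∀ l l', (v : ℝ) * ∑ k, c l k * c l' k = if l = l' then 1 else 0) :
    (∀ l, HasLaw (fun ω => ∑ k, c l k * X k ω) (gaussianReal 0 1) P) ∧
      iIndepFun (fun l ω => ∑ k, c l k * X k ω) P := by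
  classical
  have hX : ∀ k, HasGaussianLaw (X k) P := fun k => (hlaw k).hasGaussianLaw
  have hcov : ∀ k k', cov[X k, X k'; P] = if k = k' then (v : ℝ) else 0 := by
    intro k k'
    split_ifs with hk
    · subst hk
      rw [covariance_self (hX k).aemeasurable, (hlaw k).variance_eq, variance_id_gaussianReal]
    · exact (hind.indepFun hk).covariance_eq_zero (hX k).memLp_two (hX k').memLp_two
  have hjoint : HasGaussianLaw (fun ω l => ∑ k, c l k * X k ω) P := by
    have h := (hind.hasGaussianLaw hX).map_fun
      (LinearMap.toContinuousLinearMap (Matrix.mulVecLin (Matrix.of c)))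
    refine h.congr (ae_of_all _ fun ω => ?_)
    ext l
    simp [Matrix.mulVec, dotProduct]
  have hcovg : ∀ l l', cov[fun ω => ∑ k, c l k * X k ω, fun ω => ∑ k, c l' k * X k ω; P]
      = if l = l' then 1 else 0 := by
    intro l l'
    rw [covariance_fun_sum_fun_sum (fun k => (hX k).memLp_two.const_mul _)
      (fun k => (hX k).memLp_two.const_mul _), ← hc l l', Finset.mul_sum]
    refine Finset.sum_congr rfl fun k _ => ?_
    simp_rw [covariance_const_mul_left, covariance_const_mul_right, hcov]
    simp
    ring
  refine ⟨fun l => ⟨(hjoint.eval l).aemeasurable, ?_⟩,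
    hjoint.iIndepFun_of_covariance_eq_zero fun l l' hll => by rw [hcovg, if_neg hll]⟩
  rw [(hjoint.eval l).map_eq_gaussianReal, ← covariance_self (hjoint.eval l).aemeasurable, hcovg]
  congr 1
  · rw [integral_finsetSum _ fun k _ => (hX k).integrable.const_mul _]
    refine Finset.sum_eq_zero fun k _ => ?_
    rw [integral_const_mul, (hlaw k).integral_eq, integral_id_gaussianReal, mul_zero]
  · simp

theorem IsGaussianMeasurement.measureReal_norm_sq_deviation_le {d : ℕ} {n : Fin d → ℕ}
    {a : Fin m × MultiIndex n → Ω → ℝ} (ha : IsGaussianMeasurement P a) (hm : 0 < m)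
    {s : ℝ} (hs0 : 0 ≤ s) (hs1 : s ≤ 1) (z : TensorSpace n) :
    P.real {ω | s * ‖z‖ ^ 2 < |‖measurementMap (fun k => a k ω) z‖ ^ 2 - ‖z‖ ^ 2|}
      ≤ 2 * Real.exp (-(m * s ^ 2 / 16)) := by
  by_cases hz : z = 0
  · subst hz
    simp only [norm_zero, map_zero, ne_eq, OfNat.ofNat_ne_zero, not_false_eq_true, zero_pow,
      mul_zero, sub_self, abs_zero, lt_self_iff_false, Set.ofPred_false, measureReal_empty]
    positivity
  have hz0 : 0 < ‖z‖ := norm_pos_iff.2 hz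
  have hm0 : (0 : ℝ) < m := by exact_mod_cast hm
  have hsum : ∑ μ, z μ * z μ = ‖z‖ ^ 2 := by
    rw [EuclideanSpace.norm_sq_eq]; simp [sq]
  -- These coefficients make the `l`-th linear form equal to `√m / ‖z‖ * (A z) l`. Distinct `l` use
  -- disjoint sets of entries, so the forms are i.i.d. standard normal.
  set c : Fin m → Fin m × MultiIndex n → ℝ :=
    fun l k => if k.1 = l then √m / ‖z‖ * z k.2 else 0 with hcdef
  have hc : ∀ l l', (((1 / (m : ℝ≥0) : ℝ≥0)) : ℝ) * ∑ k, c l k * c l' k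
      = if l = l' then 1 else 0 := by
    intro l l'
    rw [Fintype.sum_prod_type]
    simp only [hcdef, ite_mul, zero_mul, mul_ite, mul_zero]
    split_ifs with hll
    · subst hll
      have : ∀ x : Fin m, ∑ y : MultiIndex n, (if x = l then
          (if x = l then √m / ‖z‖ * z y * (√m / ‖z‖ * z y) else 0) else 0)
          = if x = l then (m / ‖z‖ ^ 2) * ∑ y, z y * z y else 0 := by
        intro x
        split_ifs
        · rw [Finset.mul_sum]
          refine Finset.sum_congr rfl fun y _ => ?_
          have := Real.mul_self_sqrt hm0.le
          field_simp
          rw [Real.sq_sqrt hm0.le, mul_comm]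
        · simp
      rw [Finset.sum_congr rfl fun x _ => this x, hsum]
      simp
      field_simp
    · rw [Finset.sum_eq_zero, mul_zero]
      intro x _
      refine Finset.sum_eq_zero fun y _ => ?_
      split_ifs with h1 h2
      · exact absurd (h2.symm.trans h1) hll
      all_goals simp_all
  obtain ⟨hl, hi⟩ := hasLaw_and_iIndepFun_of_orthonormal ha.hasLaw ha.indep hc
  have hg : ∀ l ω, ∑ k, c l k * a k ω
      = √m / ‖z‖ * (measurementMap (fun k => a k ω) z) l := by
    intro l ω
    rw [Fintype.sum_prod_type]
    simp only [hcdef, ite_mul, zero_mul]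
    rw [Finset.sum_eq_single l]
    · simp only [if_true, measurementMap, LinearMap.coe_mk, AddHom.coe_mk, Finset.mul_sum]
      refine Finset.sum_congr rfl fun y _ => ?_
      ring
    · intro x _ hx; simp [hx]
    · simp
  refine le_trans (measureReal_mono ?_) (measureReal_abs_sum_sq_sub_one_ge_le hl hi hs0 hs1)
  intro ω hω
  simp only [Set.mem_ofPred_eq, hg] at hω ⊢
  have h1 : ∑ l, ((√m / ‖z‖ * (measurementMap (fun k => a k ω) z) l) ^ 2 - 1)
      = m / ‖z‖ ^ 2 * (‖measurementMap (fun k => a k ω) z‖ ^ 2 - ‖z‖ ^ 2) := by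
    rw [Finset.sum_sub_distrib, EuclideanSpace.norm_sq_eq (measurementMap _ z), mul_sub,
      Finset.mul_sum]
    congr 1
    · refine Finset.sum_congr rfl fun l _ => ?_
      rw [mul_pow, div_pow, Real.sq_sqrt hm0.le, Real.norm_eq_abs, sq_abs]
    · rw [div_mul_cancel₀ _ (by positivity)]; simp
  rw [h1, abs_mul, abs_of_pos (by positivity), div_mul_eq_mul_div, le_div_iff₀ (by positivity)]
  nlinarith

end Concentration

/-! ### Nets of unit balls by volume comparison -/

section Nets

variable {E : Type*} [NormedAddCommGroup E] [NormedSpace ℝ E] [FiniteDimensional ℝ E]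

/-- Volumetric bound for the size of an `η`-separated subset of the unit ball. -/
theorem card_le_of_separated_unitBall {η : ℝ} (hη : 0 < η) (s : Finset E)
    (hs : ∀ c ∈ s, ‖c‖ ≤ 1) (h : ∀ c ∈ s, ∀ d ∈ s, c ≠ d → η ≤ ‖c - d‖) :
    (s.card : ℝ) ≤ (1 + 2 / η) ^ Module.finrank ℝ E := by
  borelize E
  let μ : Measure E := Measure.addHaar
  have hδ : 0 < η / 2 := by positivity
  have hρ : 0 < 1 + η / 2 := by positivity
  have D : Set.Pairwise (s : Set E) (Function.onFun Disjoint fun c => Metric.ball c (η / 2)) := by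
    rintro c hc d hd hcd
    apply Metric.ball_disjoint_ball
    rw [dist_eq_norm, add_halves]
    exact h c hc d hd hcd
  have hsub : (⋃ c ∈ s, Metric.ball (c : E) (η / 2)) ⊆ Metric.ball (0 : E) (1 + η / 2) := by
    refine Set.iUnion₂_subset fun x hx => Metric.ball_subset_ball' ?_
    rw [dist_zero_right]
    linarith [hs x hx]
  have I : (s.card : ℝ≥0∞) * ENNReal.ofReal ((η / 2) ^ Module.finrank ℝ E) * μ (Metric.ball 0 1) ≤
      ENNReal.ofReal ((1 + η / 2) ^ Module.finrank ℝ E) * μ (Metric.ball 0 1) :=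
    calc
      _ = μ (⋃ c ∈ s, Metric.ball (c : E) (η / 2)) := by
        rw [measure_biUnion_finset D fun c _ => measurableSet_ball]
        simp only [μ.addHaar_ball_of_pos _ hδ, Finset.sum_const, nsmul_eq_mul, mul_assoc]
      _ ≤ μ (Metric.ball (0 : E) (1 + η / 2)) := measure_mono hsub
      _ = _ := by simp only [μ.addHaar_ball_of_pos _ hρ]
  have J := (ENNReal.mul_le_mul_iff_left (Metric.measure_ball_pos _ _ zero_lt_one).ne'
    measure_ball_lt_top.ne).1 I
  have K := ENNReal.toReal_le_of_le_ofReal (by positivity) J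
  rw [ENNReal.toReal_mul, ENNReal.toReal_natCast, ENNReal.toReal_ofReal (by positivity),
    ← le_div_iff₀ (by positivity), ← div_pow] at K
  refine K.trans (le_of_eq ?_)
  congr 1
  field_simp
  ring

/-- The unit ball of a finite-dimensional normed space has an `η`-net of size at most
`(1 + 2 / η) ^ dim`. -/
theorem exists_finset_net_unitBall (E : Type*) [NormedAddCommGroup E] [NormedSpace ℝ E]
    [FiniteDimensional ℝ E] {η : ℝ} (hη : 0 < η) :
    ∃ N : Finset E, (∀ x ∈ N, ‖x‖ ≤ 1) ∧ (∀ x, ‖x‖ ≤ 1 → ∃ y ∈ N, ‖x - y‖ ≤ η) ∧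
      (N.card : ℝ) ≤ (1 + 2 / η) ^ Module.finrank ℝ E := by
  classical
  let S : Set (Finset E) :=
    {s | (∀ c ∈ s, ‖c‖ ≤ 1) ∧ ∀ c ∈ s, ∀ d ∈ s, c ≠ d → η ≤ ‖c - d‖}
  -- A separated set of largest cardinality is a net: a point far from all its members could be
  -- added.
  have hbdd : BddAbove (Finset.card '' S) := by
    refine ⟨⌊(1 + 2 / η) ^ Module.finrank ℝ E⌋₊, ?_⟩
    rintro _ ⟨s, hs, rfl⟩
    exact Nat.le_floor (card_le_of_separated_unitBall hη s hs.1 hs.2)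
  have hne : (Finset.card '' S).Nonempty := ⟨0, ∅, by simp [S], by simp⟩
  obtain ⟨N, hN, hcard⟩ := Nat.sSup_mem hne hbdd
  refine ⟨N, hN.1, fun x hx => ?_, card_le_of_separated_unitBall hη N hN.1 hN.2⟩
  by_contra! hfar
  have hxN : x ∉ N := fun hxN => by
    have := hfar x hxN
    simp only [sub_self, norm_zero] at this
    linarith
  have hins : insert x N ∈ S := by
    refine ⟨fun c hc => ?_, fun c hc d hd hcd => ?_⟩
    · rcases Finset.mem_insert.1 hc with rfl | hc
      · exact hx
      · exact hN.1 c hc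
    · rcases Finset.mem_insert.1 hc with rfl | hcN <;>
        rcases Finset.mem_insert.1 hd with rfl | hdN
      · exact absurd rfl hcd
      · exact (hfar d hdN).le
      · rw [norm_sub_rev]; exact (hfar c hcN).le
      · exact hN.2 c hcN d hdN hcd
  have := le_csSup hbdd ⟨_, hins, rfl⟩
  rw [Finset.card_insert_of_notMem hxN, ← hcard] at this
  omega

end Nets

/-! ### Reduction of near-isometry to finitely many test points -/

section Multilinear

variable {ι : Type*} [Fintype ι] {E : ι → Type*} [∀ i, NormedAddCommGroup (E i)]
  [∀ i, NormedSpace ℝ (E i)]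

/-- By homogeneity in each slot, every argument can be scaled to norm one separately, which stays in
the unit ball of the sup norm. -/
theorem ContinuousMultilinearMap.opNorm_le_of_unitBall {G : Type*} [NormedAddCommGroup G]
    [NormedSpace ℝ G] (f : ContinuousMultilinearMap ℝ E G) {C : ℝ} (hC : 0 ≤ C)
    (h : ∀ p, ‖p‖ ≤ 1 → ‖f p‖ ≤ C) : ‖f‖ ≤ C := by
  refine f.opNorm_le_bound hC fun p => ?_
  by_cases hp : ∃ i, p i = 0
  · obtain ⟨i, hi⟩ := hp
    rw [f.map_coord_zero i hi, norm_zero]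
    positivity
  · push Not at hp
    have hsc : p = fun i => ‖p i‖ • (‖p i‖⁻¹ • p i) := by
      ext i
      rw [smul_smul, mul_inv_cancel₀ (norm_ne_zero_iff.2 (hp i)), one_smul]
    rw [hsc, f.map_smul_univ, ← hsc, norm_smul, Real.norm_of_nonneg (by positivity), mul_comm]
    refine mul_le_mul_of_nonneg_right (h _ ?_) (by positivity)
    refine (pi_norm_le_iff_of_nonneg zero_le_one).2 fun i => ?_
    rw [norm_smul, norm_inv, norm_norm, inv_mul_cancel₀ (norm_ne_zero_iff.2 (hp i))]

theorem ContinuousMultilinearMap.norm_sub_le_quarter [Nonempty ι]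
    (f : ContinuousMultilinearMap ℝ E ℝ) {C : ℝ} (hC : ‖f‖ ≤ C) {p p' : ∀ i, E i}
    (hp : ‖p‖ ≤ 1) (hp' : ‖p'‖ ≤ 1) (hpp' : ‖p - p'‖ ≤ 1 / (4 * Fintype.card ι)) :
    |f p - f p'| ≤ C / 4 := by
  have hK : (0 : ℝ) < Fintype.card ι := by exact_mod_cast Fintype.card_pos
  have hpow : max ‖p‖ ‖p'‖ ^ (Fintype.card ι - 1) ≤ 1 :=
    pow_le_one₀ (le_max_of_le_left (norm_nonneg _)) (max_le hp hp')
  have hC0 : 0 ≤ C := (norm_nonneg _).trans hC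
  calc |f p - f p'| ≤ ‖f‖ * Fintype.card ι * max ‖p‖ ‖p'‖ ^ (Fintype.card ι - 1) * ‖p - p'‖ :=
        f.norm_image_sub_le p p'
    _ ≤ C * Fintype.card ι * 1 * (1 / (4 * Fintype.card ι)) := by gcongr
    _ = C / 4 := by field_simp

/-- If `T` is a multilinear map of norm at most `1`, it suffices to control the deviation of `A`
from an isometry on finitely many points in order to control it on the image under `T` of the
unit ball. -/
theorem ContinuousMultilinearMap.exists_finset_isometry_test [Nonempty ι]
    [∀ i, FiniteDimensional ℝ (E i)] {H : Type*} [NormedAddCommGroup H] [InnerProductSpace ℝ H]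
    (T : ContinuousMultilinearMap ℝ E H) (hT : ‖T‖ ≤ 1) :
    ∃ Z : Finset H,
      (Z.card : ℝ) ≤ 2 * ((1 + 8 * Fintype.card ι) ^ Module.finrank ℝ (∀ i, E i)) ^ 2 ∧
      ∀ (F : Type) [NormedAddCommGroup F] [InnerProductSpace ℝ F] (A : H →L[ℝ] F) (s : ℝ), 0 ≤ s →
        (∀ z ∈ Z, |‖A z‖ ^ 2 - ‖z‖ ^ 2| ≤ s * ‖z‖ ^ 2) →
        ∀ p, ‖p‖ ≤ 1 → |‖A (T p)‖ ^ 2 - ‖T p‖ ^ 2| ≤ 2 * s := by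
  classical
  have hK : (0 : ℝ) < Fintype.card ι := by exact_mod_cast Fintype.card_pos
  obtain ⟨N, hN1, hN2, hN3⟩ := exists_finset_net_unitBall (∀ i, E i)
    (η := 1 / (4 * Fintype.card ι)) (by positivity)
  rw [show (2 : ℝ) / (1 / (4 * Fintype.card ι)) = 8 * Fintype.card ι by field_simp; norm_num] at hN3
  refine ⟨(N ×ˢ N).image (fun pq => T pq.1 + T pq.2) ∪
    (N ×ˢ N).image (fun pq => T pq.1 - T pq.2), ?_, ?_⟩
  · have h1 : (((N ×ˢ N).image (fun pq => T pq.1 + T pq.2) ∪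
        (N ×ˢ N).image (fun pq => T pq.1 - T pq.2)).card : ℝ) ≤ 2 * (N.card : ℝ) ^ 2 := by
      have := (Finset.card_union_le ((N ×ˢ N).image (fun pq => T pq.1 + T pq.2))
        ((N ×ˢ N).image (fun pq => T pq.1 - T pq.2))).trans
        (add_le_add Finset.card_image_le Finset.card_image_le)
      rw [Finset.card_product] at this
      calc _ ≤ ((N.card * N.card + N.card * N.card : ℕ) : ℝ) := by exact_mod_cast this
        _ = _ := by push_cast; ring
    refine h1.trans ?_
    gcongr
  · intro F _ _ A s hs hZ p hp
    have hTle : ∀ q, ‖q‖ ≤ 1 → ‖T q‖ ≤ 1 := fun q hq =>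
      (T.le_opNorm q).trans (mul_le_one₀ hT (by positivity)
        (Finset.prod_le_one (fun _ _ => norm_nonneg _) fun i _ => (norm_le_pi_norm q i).trans hq))
    -- The symmetric form of `A* A - 1`. Fixing one argument leaves a functional that composes with
    -- `T` to a multilinear map.
    let b : H → H →L[ℝ] ℝ := fun y => (innerSL ℝ (A y)).comp A - innerSL ℝ y
    have hb : ∀ x y, b y x = inner ℝ (A y) (A x) - inner ℝ y x := fun x y => by
      simp [b]
    have hsymm : ∀ x y, b y x = b x y := fun x y => by
      rw [hb, hb, real_inner_comm, real_inner_comm x y]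
    have hdiag : ∀ x, b x x = ‖A x‖ ^ 2 - ‖x‖ ^ 2 := fun x => by
      rw [hb, real_inner_self_eq_norm_sq, real_inner_self_eq_norm_sq]
    have hnet : ∀ p ∈ N, ∀ q ∈ N, |b (T q) (T p)| ≤ s := by
      intro p hp q hq
      have hplus := abs_le.1 (hZ (T p + T q) (Finset.mem_union_left _
        (Finset.mem_image.2 ⟨(p, q), Finset.mk_mem_product hp hq, rfl⟩)))
      have hminus := abs_le.1 (hZ (T p - T q) (Finset.mem_union_right _
        (Finset.mem_image.2 ⟨(p, q), Finset.mk_mem_product hp hq, rfl⟩)))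
      have hpol : 4 * b (T q) (T p)
          = (‖A (T p + T q)‖ ^ 2 - ‖T p + T q‖ ^ 2) - (‖A (T p - T q)‖ ^ 2 - ‖T p - T q‖ ^ 2) := by
        rw [hb, map_add, map_sub, norm_add_sq_real, norm_add_sq_real, norm_sub_sq_real,
          norm_sub_sq_real, real_inner_comm (A (T p)), real_inner_comm (T p)]
        ring
      have hpar := parallelogram_law_with_norm ℝ (T p) (T q)
      have hp1 : ‖T p‖ ^ 2 ≤ 1 := pow_le_one₀ (norm_nonneg _) (hTle p (hN1 p hp))
      have hq1 : ‖T q‖ ^ 2 ≤ 1 := pow_le_one₀ (norm_nonneg _) (hTle q (hN1 q hq))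
      -- The parallelogram law makes the two squared norms sum to at most `4`, matching the `4` of
      -- polarisation.
      have hbound : s * ‖T p + T q‖ ^ 2 + s * ‖T p - T q‖ ^ 2 ≤ 4 * s := by nlinarith
      exact abs_le.2 ⟨by linarith, by linarith⟩
    -- The supremum runs over independent `p` and `q`: on the diagonal alone the form is not
    -- multilinear in `p`.
    let V : Set ℝ := {x | ∃ p q, ‖p‖ ≤ 1 ∧ ‖q‖ ≤ 1 ∧ x = |b (T q) (T p)|}
    have hVbdd : BddAbove V := by
      refine ⟨‖A‖ * ‖A‖ + 1, ?_⟩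
      rintro _ ⟨p, q, hp, hq, rfl⟩
      have hAp : ‖A (T p)‖ ≤ ‖A‖ := A.le_of_opNorm_le_of_le le_rfl (hTle p hp) |>.trans_eq
        (mul_one _)
      have hAq : ‖A (T q)‖ ≤ ‖A‖ := A.le_of_opNorm_le_of_le le_rfl (hTle q hq) |>.trans_eq
        (mul_one _)
      rw [hb]
      refine (abs_sub _ _).trans (add_le_add ?_ ?_)
      · exact (abs_real_inner_le_norm _ _).trans
          (mul_le_mul hAq hAp (norm_nonneg _) (norm_nonneg _))
      · exact (abs_real_inner_le_norm _ _).trans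
          (mul_le_one₀ (hTle q hq) (norm_nonneg _) (hTle p hp))
    set Δ := sSup V with hΔ
    have hle : ∀ p q, ‖p‖ ≤ 1 → ‖q‖ ≤ 1 → |b (T q) (T p)| ≤ Δ := fun p q hp hq =>
      le_csSup hVbdd ⟨p, q, hp, hq, rfl⟩
    have hΔ0 : 0 ≤ Δ := (abs_nonneg _).trans (hle p p hp hp)
    have hmove : ∀ p p' q, ‖p‖ ≤ 1 → ‖p'‖ ≤ 1 → ‖q‖ ≤ 1 → ‖p - p'‖ ≤ 1 / (4 * Fintype.card ι) →
        |b (T q) (T p) - b (T q) (T p')| ≤ Δ / 4 := by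
      intro p p' q hp hp' hq hpp'
      exact ((b (T q)).compContinuousMultilinearMap T).norm_sub_le_quarter
        (ContinuousMultilinearMap.opNorm_le_of_unitBall _ hΔ0 fun x hx => hle x q hx hq) hp hp' hpp'
    -- Two moves of cost `Δ / 4`, one per argument. The finiteness of `Δ` allows absorbing `Δ / 2`.
    have hΔs : Δ ≤ s + Δ / 2 := by
      refine csSup_le ⟨_, p, p, hp, hp, rfl⟩ ?_
      rintro _ ⟨x, y, hx, hy, rfl⟩
      obtain ⟨x', hx', hxx'⟩ := hN2 x hx
      obtain ⟨y', hy', hyy'⟩ := hN2 y hy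
      have h1 := abs_le.1 (hmove x x' y hx (hN1 x' hx') hy hxx')
      have h2 := abs_le.1 (hmove y y' x' hy (hN1 y' hy') (hN1 x' hx') hyy')
      have h3 := abs_le.1 (hnet x' hx' y' hy')
      rw [hsymm (T y), hsymm (T y')] at h2
      exact abs_le.2 ⟨by linarith, by linarith⟩
    rw [← hdiag]
    linarith [hle p p hp hp]

end Multilinear

/-! ### Applying a matrix in every mode -/

section ModeProduct

theorem Fin.sum_pi_succ {d : ℕ} {α : Fin (d + 1) → Type*} [∀ i, Fintype (α i)]
    (f : (∀ i, α i) → ℝ) :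
    ∑ ν, f ν = ∑ a : α 0, ∑ ν : ∀ i : Fin d, α i.succ, f (Fin.cons a ν) := by
  rw [← Fintype.sum_prod_type']
  exact (Fintype.sum_equiv (Fin.consEquiv α) _ _ fun _ => rfl).symm

/-- The tensor obtained from `S` by applying the matrix `M i` in mode `i`, for every `i`. -/
def modeProduct {d : ℕ} {α β : Fin d → Type} [∀ i, Fintype (α i)] (M : ∀ i, β i → α i → ℝ)
    (S : (∀ i, α i) → ℝ) (μ : ∀ i, β i) : ℝ :=
  ∑ ν, (∏ i, M i (μ i) (ν i)) * S ν

theorem modeProduct_cons {d : ℕ} {α β : Fin (d + 1) → Type} [∀ i, Fintype (α i)]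
    (M : ∀ i, β i → α i → ℝ) (S : (∀ i, α i) → ℝ) (b : β 0) (μ : ∀ i : Fin d, β i.succ) :
    modeProduct M S (Fin.cons b μ) =
      ∑ a, M 0 b a * modeProduct (fun i => M i.succ) (fun ν => S (Fin.cons a ν)) μ := by
  simp only [modeProduct, Fin.sum_pi_succ, Fin.prod_univ_succ, Fin.cons_zero, Fin.cons_succ,
    Finset.mul_sum, mul_assoc]

/-- Modes act independently, so their squared norm bounds multiply; the induction peels off mode
`0`. -/
theorem sum_sq_modeProduct_le {d : ℕ} {α β : Fin d → Type} [∀ i, Fintype (α i)]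
    [∀ i, Fintype (β i)] (M : ∀ i, β i → α i → ℝ) (C : Fin d → ℝ) (hC : ∀ i, 0 ≤ C i)
    (hM : ∀ i (v : α i → ℝ), ∑ b, (∑ a, M i b a * v a) ^ 2 ≤ C i * ∑ a, v a ^ 2) (S : (∀ i, α i) → ℝ) :
    ∑ μ, modeProduct M S μ ^ 2 ≤ (∏ i, C i) * ∑ ν, S ν ^ 2 := by
  induction d with
  | zero => simp [modeProduct]
  | succ d ih =>
    rw [Fin.sum_pi_succ, Fin.sum_pi_succ, Finset.sum_comm, Fin.prod_univ_succ]
    simp only [modeProduct_cons]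
    calc _ ≤ ∑ μ : ∀ i : Fin d, β i.succ, C 0 * ∑ a, modeProduct (fun i => M i.succ)
            (fun ν => S (Fin.cons a ν)) μ ^ 2 := Finset.sum_le_sum fun μ _ => hM 0 _
      _ = C 0 * ∑ a, ∑ μ, modeProduct (fun i => M i.succ) (fun ν => S (Fin.cons a ν)) μ ^ 2 := by
          rw [← Finset.mul_sum, Finset.sum_comm]
      _ ≤ C 0 * ∑ a, (∏ i : Fin d, C i.succ) * ∑ ν, S (Fin.cons a ν) ^ 2 :=
          mul_le_mul_of_nonneg_left (Finset.sum_le_sum fun a _ =>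
            ih _ _ (fun i => hC i.succ) (fun i => hM i.succ) _) (hC 0)
      _ = _ := by rw [← Finset.mul_sum, mul_assoc]

theorem modeProduct_modeProduct {d : ℕ} {α β γ : Fin d → Type} [∀ i, Fintype (α i)]
    [∀ i, Fintype (β i)] (M : ∀ i, γ i → β i → ℝ) (N : ∀ i, β i → α i → ℝ)
    (S : (∀ i, α i) → ℝ) :
    modeProduct M (modeProduct N S) = modeProduct (fun i c a => ∑ b, M i c b * N i b a) S := by
  ext μ
  simp only [modeProduct, Finset.prod_univ_sum, Fintype.piFinset_univ, Finset.mul_sum,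
    Finset.sum_mul]
  rw [Finset.sum_comm]
  simp only [Finset.prod_mul_distrib, mul_assoc]

/-- If each matrix fixes every fibre of `S` in its own mode, applying them one mode after another
never changes `S`. -/
theorem modeProduct_eq_self {d : ℕ} {α : Fin d → Type} [∀ i, Fintype (α i)]
    (M : ∀ i, α i → α i → ℝ) (S : (∀ i, α i) → ℝ)
    (h : ∀ i μ, ∑ t, M i (μ i) t * S (Function.update μ i t) = S μ) :
    modeProduct M S = S := by
  induction d with
  | zero =>
    ext μ
    simp only [modeProduct, Finset.univ_eq_empty, Finset.prod_empty, one_mul,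
      Finset.univ_unique, Finset.sum_singleton]
    exact congrArg S (Subsingleton.elim _ _)
  | succ d ih =>
    ext μ
    rw [← Fin.cons_self_tail μ, modeProduct_cons]
    have hrec : ∀ a, modeProduct (fun i => M (Fin.succ i)) (fun ν => S (Fin.cons a ν))
        = fun ν => S (Fin.cons a ν) := fun a => by
      refine ih _ _ fun i ν => ?_
      have := h i.succ (Fin.cons a ν)
      simpa only [Fin.cons_succ, ← Fin.cons_update] using this
    simp only [hrec]
    have := h 0 (Fin.cons (μ 0) (Fin.tail μ))
    simpa only [Fin.cons_zero, Fin.update_cons_zero] using this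

end ModeProduct

/-! ### Matrix entries of operators, and padded orthonormal systems -/

section Entries

variable {α β : Type} [Fintype α] [DecidableEq α] [Fintype β]

/-- The entry at `(b, a)` of the matrix of a linear map. -/
noncomputable def opEntry (b : β) (a : α) :
    (EuclideanSpace ℝ α →L[ℝ] EuclideanSpace ℝ β) →ₗ[ℝ] ℝ where
  toFun U := U (EuclideanSpace.single a 1) b
  map_add' U V := by simp
  map_smul' c U := by simp

theorem apply_eq_sum_opEntry (U : EuclideanSpace ℝ α →L[ℝ] EuclideanSpace ℝ β)
    (v : EuclideanSpace ℝ α) (b : β) : U v b = ∑ a, opEntry b a U * v a := by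
  have hv : v = ∑ a, v a • EuclideanSpace.single a (1 : ℝ) := by
    ext i
    simp [Finset.sum_apply, Pi.single_apply]
  conv_lhs => rw [hv]
  simp [opEntry, Finset.sum_apply, mul_comm]

theorem sum_sq_sum_opEntry_mul_le (U : EuclideanSpace ℝ α →L[ℝ] EuclideanSpace ℝ β) (v : α → ℝ) :
    ∑ b, (∑ a, opEntry b a U * v a) ^ 2 ≤ ‖U‖ ^ 2 * ∑ a, v a ^ 2 := by
  have h := U.le_opNorm (WithLp.toLp 2 v)
  have h2 := pow_le_pow_left₀ (norm_nonneg _) h 2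
  rw [mul_pow, EuclideanSpace.norm_sq_eq, EuclideanSpace.norm_sq_eq] at h2
  simpa [apply_eq_sum_opEntry] using h2

theorem exists_opEntry_eq (M : β → α → ℝ)
    (hM : ∀ v : α → ℝ, ∑ b, (∑ a, M b a * v a) ^ 2 ≤ ∑ a, v a ^ 2) :
    ∃ U : EuclideanSpace ℝ α →L[ℝ] EuclideanSpace ℝ β, ‖U‖ ≤ 1 ∧ ∀ b a, opEntry b a U = M b a := by
  let U : EuclideanSpace ℝ α →L[ℝ] EuclideanSpace ℝ β :=
    LinearMap.toContinuousLinearMap (Matrix.toEuclideanLin (Matrix.of M))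
  have hU : ∀ v b, U v b = ∑ a, M b a * v a := fun v b => by
    simp [U, Matrix.toLpLin_apply, Matrix.mulVec, dotProduct]
  refine ⟨U, U.opNorm_le_bound zero_le_one fun v => ?_, fun b a => ?_⟩
  · rw [one_mul, ← abs_of_nonneg (norm_nonneg (U v)), ← abs_of_nonneg (norm_nonneg v), ← sq_le_sq,
      EuclideanSpace.norm_sq_eq, EuclideanSpace.norm_sq_eq]
    simpa [hU] using hM v
  · change U (EuclideanSpace.single a 1) b = M b a
    rw [hU]
    simp

end Entries

/-- An orthonormal basis of a subspace of dimension at most `r`, padded with zeros. -/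
theorem Submodule.exists_padded_orthonormal {H : Type*} [NormedAddCommGroup H]
    [InnerProductSpace ℝ H] (V : Submodule ℝ H) [FiniteDimensional ℝ V] {r : ℕ}
    (hV : Module.finrank ℝ V ≤ r) :
    ∃ Q : Fin r → H, (∀ j, Q j ∈ V) ∧ (∀ x ∈ V, ∑ j, inner ℝ (Q j) x • Q j = x) ∧
      ∀ c : Fin r → ℝ, ‖∑ j, c j • Q j‖ ^ 2 ≤ ∑ j, c j ^ 2 := by
  let b := stdOrthonormalBasis ℝ V
  let e : Fin (Module.finrank ℝ V) → Fin r := Fin.castLE hV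
  have he : Function.Injective e := Fin.castLE_injective hV
  let Q : Fin r → H := fun j => if h : (j : ℕ) < Module.finrank ℝ V then b ⟨j, h⟩ else 0
  have hQe : ∀ i, Q (e i) = b i := fun i => by simp [Q, e]
  have hQ0 : ∀ j, j ∉ Set.range e → Q j = 0 := fun j hj => by
    have : ¬ (j : ℕ) < Module.finrank ℝ V := fun h => hj ⟨⟨j, h⟩, by ext; simp [e]⟩
    simp [Q, this]
  refine ⟨Q, fun j => ?_, fun x hx => ?_, fun c => ?_⟩
  · by_cases h : (j : ℕ) < Module.finrank ℝ V <;> simp [Q, h]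
  · rw [← Fintype.sum_of_injective e he (fun i => inner ℝ (b i : H) x • (b i : H)) _
      (fun j hj => by rw [hQ0 j hj, smul_zero]) (fun i => by rw [hQe])]
    have := congrArg (Subtype.val) (b.sum_repr' ⟨x, hx⟩)
    simpa using this
  · rw [← Fintype.sum_of_injective e he (fun i => c (e i) • (b i : H)) _
      (fun j hj => by rw [hQ0 j hj, smul_zero]) (fun i => by rw [hQe])]
    have h1 : ∑ i, c (e i) • (b i : H) = ((∑ i, c (e i) • b i : V) : H) := by simp
    rw [h1, Submodule.norm_coe, ← real_inner_self_eq_norm_sq,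
      b.orthonormal.inner_sum]
    simp only [conj_trivial, ← sq]
    rw [← Finset.sum_image (f := fun j => c j ^ 2) (s := Finset.univ) (g := e) he.injOn]
    exact Finset.sum_le_univ_sum_of_nonneg fun _ => sq_nonneg _

/-- The adjoint of a contraction is a contraction: the sum `S` is `⟪y, x⟫` with `‖y‖ ^ 2 ≤ S`, and
Cauchy–Schwarz gives `S ^ 2 ≤ S ‖x‖ ^ 2`. -/
theorem sum_inner_sq_le_of_norm_sum_smul_le {H κ : Type*} [NormedAddCommGroup H]
    [InnerProductSpace ℝ H] [Fintype κ] {Q : κ → H}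
    (hQ : ∀ c : κ → ℝ, ‖∑ j, c j • Q j‖ ^ 2 ≤ ∑ j, c j ^ 2) (x : H) :
    ∑ j, inner ℝ (Q j) x ^ 2 ≤ ‖x‖ ^ 2 := by
  set y := ∑ j, inner ℝ (Q j) x • Q j with hy
  set S := ∑ j, inner ℝ (Q j) x ^ 2 with hS
  have hS0 : 0 ≤ S := Finset.sum_nonneg fun _ _ => sq_nonneg _
  have hyx : inner ℝ y x = S := by
    rw [hy, sum_inner]
    exact Finset.sum_congr rfl fun j _ => by rw [real_inner_smul_left, sq]
  have h1 : ‖y‖ ^ 2 ≤ S := hQ _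
  have h2 : S ≤ ‖y‖ * ‖x‖ := hyx ▸ real_inner_le_norm y x
  by_contra! h
  nlinarith [mul_le_mul h2 h2 hS0 (by positivity), norm_nonneg x, norm_nonneg y,
    mul_le_mul_of_nonneg_right h1 (sq_nonneg ‖x‖), mul_pos ((sq_nonneg ‖x‖).trans_lt h) (sub_pos.2 h)]

/-! ### Ranks of matricisations as dimensions of spans of slices -/

section Slices

variable {d : ℕ} {n : Fin d → ℕ}

/-- The column of `U^α` with index `(μ_i)_{i ∉ α}`, as a function of a full multi-index. -/
def colSlice (u : TensorSpace n) (α : Finset (Fin d)) (μ : MultiIndex n) : MultiIndex n → ℝ :=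
  fun τ => u fun i => if i ∈ α then τ i else μ i

/-- The row of `U^α` with index `(μ_i)_{i ∈ α}`, as a function of a full multi-index. -/
def rowSlice (u : TensorSpace n) (α : Finset (Fin d)) (μ : MultiIndex n) : MultiIndex n → ℝ :=
  fun τ => u fun i => if i ∈ α then μ i else τ i

theorem finrank_span_range_comp_le {K V W X Y : Type*} [Field K] [AddCommGroup V] [Module K V]
    [AddCommGroup W] [Module K W] [FiniteDimensional K V] (L : V →ₗ[K] W) (y : Y → V) (x : X → W)
    (g : X → Y) (h : ∀ i, x i = L (y (g i))) :
    Module.finrank K (Submodule.span K (Set.range x))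
      ≤ Module.finrank K (Submodule.span K (Set.range y)) := by
  have hsub : Submodule.span K (Set.range x) ≤ (Submodule.span K (Set.range y)).map L := by
    rw [Submodule.span_le]
    rintro _ ⟨i, rfl⟩
    exact ⟨y (g i), Submodule.subset_span ⟨_, rfl⟩, (h i).symm⟩
  exact (Submodule.finrank_mono hsub).trans (Submodule.finrank_map_le L _)

theorem finrank_span_colSlice_le (u : TensorSpace n) (α : Finset (Fin d)) :
    Module.finrank ℝ (Submodule.span ℝ (Set.range (colSlice u α))) ≤ (matricisation u α).rank := by
  rw [Matrix.rank_eq_finrank_span_cols]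
  refine finrank_span_range_comp_le
    (LinearMap.funLeft ℝ ℝ fun (τ : MultiIndex n) (i : {i // i ∈ α}) => τ i) _ _
    (fun μ i => μ i) fun μ => ?_
  ext τ
  simp [colSlice, LinearMap.funLeft_apply, matricisation, Matrix.col]

theorem finrank_span_rowSlice_le (u : TensorSpace n) (α : Finset (Fin d)) :
    Module.finrank ℝ (Submodule.span ℝ (Set.range (rowSlice u α))) ≤ (matricisation u α).rank := by
  rw [Matrix.rank_eq_finrank_span_row]
  refine finrank_span_range_comp_le
    (LinearMap.funLeft ℝ ℝ fun (τ : MultiIndex n) (i : {i // i ∉ α}) => τ i) _ _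
    (fun μ i => μ i) fun μ => ?_
  ext τ
  simp [rowSlice, LinearMap.funLeft_apply, matricisation, Matrix.row]

end Slices

/-! ### Tucker decompositions with contractive factors -/

section Tucker

variable {d : ℕ}

/-- Number of columns of the factors of a Tucker decomposition; `none` stands for the core. -/
def tuckerCols (d r : ℕ) : Option (Fin d) → ℕ
  | none => 1
  | some _ => r

/-- Number of rows of the factors of a Tucker decomposition; `none` stands for the core. -/
def tuckerRows (r : ℕ) (n : Fin d → ℕ) : Option (Fin d) → ℕ
  | none => r ^ d
  | some i => n i

/-- The factors of a Tucker decomposition. The core is stored as an operator on `ℝ¹`. -/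
abbrev TuckerFactor (r : ℕ) (n : Fin d → ℕ) (o : Option (Fin d)) : Type :=
  EuclideanSpace ℝ (Fin (tuckerCols d r o)) →L[ℝ] EuclideanSpace ℝ (Fin (tuckerRows r n o))

/-- The entry of a factor that occurs in the term of index `ν` of the entry at `μ`. -/
noncomputable def tuckerEntry {r : ℕ} {n : Fin d → ℕ} (μ : MultiIndex n) (ν : Fin d → Fin r) :
    ∀ o, TuckerFactor r n o →ₗ[ℝ] ℝ
  | none => opEntry (finFunctionFinEquiv ν : Fin (r ^ d)) (0 : Fin 1)
  | some i => opEntry (α := Fin r) (β := Fin (n i)) (μ i) (ν i)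

/-- The tensor with given Tucker factors. -/
noncomputable def tuckerMultilinear (r : ℕ) (n : Fin d → ℕ) :
    MultilinearMap ℝ (TuckerFactor r n) (TensorSpace n) :=
  (WithLp.linearEquiv 2 ℝ (MultiIndex n → ℝ)).symm.toLinearMap.compMultilinearMap
    (MultilinearMap.pi fun μ => ∑ ν : Fin d → Fin r,
      (MultilinearMap.mkPiAlgebra ℝ (Option (Fin d)) ℝ).compLinearMap (tuckerEntry μ ν))

theorem tuckerMultilinear_apply {r : ℕ} {n : Fin d → ℕ} (p : ∀ o, TuckerFactor r n o)
    (μ : MultiIndex n) :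
    tuckerMultilinear r n p μ = modeProduct (α := fun _ => Fin r) (β := fun i => Fin (n i))
      (fun i b a => opEntry (α := Fin r) (β := Fin (n i)) b a (p (some i)))
      (fun ν => opEntry (finFunctionFinEquiv ν : Fin (r ^ d)) (0 : Fin 1) (p none)) μ := by
  simp [tuckerMultilinear, modeProduct, tuckerEntry, Fintype.prod_option, mul_comm]
  rfl

theorem norm_tuckerMultilinear_le {r : ℕ} {n : Fin d → ℕ} (p : ∀ o, TuckerFactor r n o) :
    ‖tuckerMultilinear r n p‖ ≤ ∏ o, ‖p o‖ := by
  rw [← abs_of_nonneg (norm_nonneg (tuckerMultilinear r n p)),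
    ← abs_of_nonneg (Finset.prod_nonneg fun o _ => norm_nonneg (p o)), ← sq_le_sq,
    EuclideanSpace.norm_sq_eq, Fintype.prod_option, mul_pow, ← Finset.prod_pow, mul_comm]
  simp only [Real.norm_eq_abs, sq_abs, tuckerMultilinear_apply]
  refine (sum_sq_modeProduct_le _ (fun i => ‖p (some i)‖ ^ 2) (fun _ => sq_nonneg _)
    (fun i v => sum_sq_sum_opEntry_mul_le (α := Fin r) (β := Fin (n i)) (p (some i)) v) _).trans ?_
  refine mul_le_mul_of_nonneg_left ?_ (Finset.prod_nonneg fun _ _ => sq_nonneg _)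
  have h := sum_sq_sum_opEntry_mul_le (α := Fin 1) (β := Fin (r ^ d)) (p none) 1
  simp only [Finset.univ_unique, Fin.default_eq_zero, Finset.sum_singleton, Pi.one_apply, mul_one,
    one_pow] at h
  refine le_trans (le_of_eq ?_) h
  exact Fintype.sum_equiv finFunctionFinEquiv _ _ fun ν => rfl

theorem finrank_pi_tuckerFactor_le (r : ℕ) (n : Fin d → ℕ) {N : ℕ} (hN : ∀ i, n i ≤ N) :
    Module.finrank ℝ (∀ o, TuckerFactor r n o) ≤ r ^ d + d * N * r := by
  have h : ∀ o, Module.finrank ℝ (TuckerFactor r n o) = tuckerCols d r o * tuckerRows r n o :=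
    fun o => by
      rw [← LinearMap.toContinuousLinearMap.finrank_eq, Module.finrank_linearMap]
      simp
  rw [Module.finrank_pi_fintype, Finset.sum_congr rfl fun o _ => h o, Fintype.sum_option]
  simp only [tuckerCols, tuckerRows, one_mul]
  gcongr
  calc ∑ i, r * n i ≤ ∑ _i : Fin d, r * N := Finset.sum_le_sum fun i _ =>
        Nat.mul_le_mul_left _ (hN i)
    _ = d * N * r := by simp; ring

/-- Let `Q i` be a padded orthonormal basis of the span of the mode-`i` fibres, of dimension at most
`r`. The core is `u` contracted with all the `Q i`, hence of norm at most one. Expanding again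
applies the projections `Q i (Q i)ᵀ`, which fix every fibre and therefore `u`. -/
theorem exists_tuckerMultilinear_eq {r : ℕ} {n : Fin d → ℕ} (u : TensorSpace n) (hu : ‖u‖ ≤ 1)
    (hr : ∀ i, (matricisation u {i}).rank ≤ r) :
    ∃ p : ∀ o, TuckerFactor r n o, ‖p‖ ≤ 1 ∧ tuckerMultilinear r n p = u := by
  let x : ∀ i, MultiIndex n → EuclideanSpace ℝ (Fin (n i)) :=
    fun i μ => WithLp.toLp 2 fun t => u (Function.update μ i t)
  have hfin : ∀ i, Module.finrank ℝ (Submodule.span ℝ (Set.range (x i))) ≤ r := by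
    intro i
    rcases isEmpty_or_nonempty (MultiIndex n) with hemp | ⟨⟨μ₀⟩⟩
    · rw [Set.range_eq_empty, Submodule.span_empty, finrank_bot]
      exact Nat.zero_le _
    · refine le_trans ?_ ((finrank_span_colSlice_le u {i}).trans (hr i))
      -- A column slice is constant outside mode `i`, so it can be read off along the fibre through
      -- any fixed `μ₀`.
      refine finrank_span_range_comp_le ((WithLp.linearEquiv 2 ℝ (Fin (n i) → ℝ)).symm.toLinearMap
        ∘ₗ LinearMap.funLeft ℝ ℝ fun t => Function.update μ₀ i t) _ _ id fun μ => ?_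
      ext t
      simp only [x, LinearMap.comp_apply, id, LinearEquiv.coe_coe, WithLp.linearEquiv_symm_apply]
      refine congrArg u (funext fun k => ?_)
      by_cases hk : k = i
      · subst hk; simp
      · simp [hk]
  choose Q hQV hQx hQc using fun i => Submodule.exists_padded_orthonormal _ (hfin i)
  let S : (Fin d → Fin r) → ℝ := modeProduct (α := fun i => Fin (n i)) (β := fun _ => Fin r)
    (fun i ν μ => Q i ν μ) u
  have hinner : ∀ i j (v : EuclideanSpace ℝ (Fin (n i))), inner ℝ (Q i j) v
      = ∑ t, Q i j t * v t := fun i j v => by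
    simp [PiLp.inner_apply, mul_comm]
  have hS : ∑ ν, S ν ^ 2 ≤ 1 := by
    refine (sum_sq_modeProduct_le _ (fun _ => 1) (fun _ => zero_le_one) (fun i v => ?_) _).trans ?_
    · have := sum_inner_sq_le_of_norm_sum_smul_le (hQc i) (WithLp.toLp 2 v)
      rw [EuclideanSpace.norm_sq_eq] at this
      simpa [hinner] using this
    · have h1 : ‖u‖ ^ 2 ≤ 1 := pow_le_one₀ (norm_nonneg _) hu
      rw [EuclideanSpace.norm_sq_eq] at h1
      simpa using h1
  obtain ⟨c, hc1, hc⟩ := exists_opEntry_eq (α := Fin 1) (β := Fin (r ^ d))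
    (fun b _ => S (finFunctionFinEquiv.symm b)) fun v => by
      simp only [Finset.univ_unique, Fin.default_eq_zero, Finset.sum_singleton, mul_pow,
        ← Finset.sum_mul]
      refine mul_le_of_le_one_left (sq_nonneg _) (le_trans (le_of_eq ?_) hS)
      exact Fintype.sum_equiv finFunctionFinEquiv.symm _ _ fun b => rfl
  choose U hU1 hU using fun i => exists_opEntry_eq (α := Fin r) (β := Fin (n i))
    (fun b a => Q i a b) fun v => by
      have := hQc i v
      rw [EuclideanSpace.norm_sq_eq] at this
      simpa [mul_comm] using this
  refine ⟨fun o => match o with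
    | none => c
    | some i => U i, ?_, ?_⟩
  · refine (pi_norm_le_iff_of_nonneg zero_le_one).2 fun o => ?_
    cases o with
    | none => exact hc1
    | some i => exact hU1 i
  · ext μ
    rw [tuckerMultilinear_apply]
    simp only [hc, hU, Equiv.symm_apply_apply]
    have hcomp := modeProduct_modeProduct (α := fun i => Fin (n i)) (β := fun _ => Fin r)
      (γ := fun i => Fin (n i)) (fun i b a => Q i a b) (fun i ν μ => Q i ν μ) u
    refine (congrFun hcomp μ).trans (congrFun (modeProduct_eq_self _ _ fun i μ => ?_) μ)
    have hx := congrArg (fun v => v (μ i)) (hQx i (x i μ) (Submodule.subset_span ⟨μ, rfl⟩))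
    simp only [hinner, x, Function.update_eq_self, WithLp.ofLp_sum, WithLp.ofLp_smul,
      Finset.sum_apply, Pi.smul_apply, smul_eq_mul] at hx
    rw [← hx]
    simp only [Finset.sum_mul]
    rw [Finset.sum_comm]
    exact Finset.sum_congr rfl fun j _ => Finset.sum_congr rfl fun t _ => by ring

end Tucker

/-! ### Tensor trains with contractive cores -/

section TensorTrain

variable {d : ℕ} {r : ℕ}

/-- The product `W₁(μ₁) ⋯ W_d(μ_d)` of the matrices selected by a multi-index. -/
def trainProd {n : Fin d → ℕ} (W : ∀ k, Fin (n k) → Matrix (Fin r) (Fin r) ℝ)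
    (μ : MultiIndex n) : Matrix (Fin r) (Fin r) ℝ :=
  (List.ofFn fun k => W k (μ k)).prod

theorem trainProd_cons {n : Fin (d + 1) → ℕ} (W : ∀ k, Fin (n k) → Matrix (Fin r) (Fin r) ℝ)
    (t : Fin (n 0)) (μ : MultiIndex fun i : Fin d => n i.succ) :
    trainProd W (Fin.cons t μ : MultiIndex n) = W 0 t * trainProd (fun k => W k.succ) μ := by
  simp [trainProd, List.ofFn_succ]

/-- The row vector `v` is pushed through the first core and the induction hypothesis is applied to
each resulting vector, so `v` has to be arbitrary. -/
theorem sum_sq_vecMul_trainProd_le {n : Fin d → ℕ}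
    (W : ∀ k, Fin (n k) → Matrix (Fin r) (Fin r) ℝ) (C : Fin d → ℝ) (hC : ∀ k, 0 ≤ C k)
    (hW : ∀ k (v : Fin r → ℝ), ∑ t, ∑ ν, (Matrix.vecMul v (W k t)) ν ^ 2 ≤ C k * ∑ ν, v ν ^ 2)
    (v : Fin r → ℝ) :
    ∑ μ, ∑ ν, (Matrix.vecMul v (trainProd W μ)) ν ^ 2 ≤ (∏ k, C k) * ∑ ν, v ν ^ 2 := by
  induction d generalizing v with
  | zero => simp [trainProd]
  | succ d ih =>
    rw [Fin.sum_pi_succ, Fin.prod_univ_succ]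
    simp only [trainProd_cons, ← Matrix.vecMul_vecMul]
    calc _ ≤ ∑ t, (∏ k : Fin d, C k.succ) * ∑ ν, (Matrix.vecMul v (W 0 t)) ν ^ 2 :=
          Finset.sum_le_sum fun t _ =>
            ih _ _ (fun k => hC k.succ) (fun k => hW k.succ) _
      _ ≤ (∏ k : Fin d, C k.succ) * (C 0 * ∑ ν, v ν ^ 2) := by
          rw [← Finset.mul_sum]
          exact mul_le_mul_of_nonneg_left (hW 0 v) (Finset.prod_nonneg fun k _ => hC k.succ)
      _ = _ := by ring

/-- The cores of a tensor train decomposition with all ranks equal to `r`. -/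
abbrev TrainCore (r : ℕ) (n : Fin d → ℕ) (k : Fin d) : Type :=
  EuclideanSpace ℝ (Fin r) →L[ℝ] EuclideanSpace ℝ (Fin (n k) × Fin r)

/-- The matrix of a core at a given value of the mode index. -/
noncomputable def trainSlice {N : ℕ} (t : Fin N) :
    (EuclideanSpace ℝ (Fin r) →L[ℝ] EuclideanSpace ℝ (Fin N × Fin r)) →ₗ[ℝ]
      Matrix (Fin r) (Fin r) ℝ where
  toFun U := Matrix.of fun ν ν' => opEntry (t, ν') ν U
  map_add' U V := by ext; simp
  map_smul' c U := by ext; simp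

theorem sum_sq_vecMul_trainSlice_le {N : ℕ}
    (U : EuclideanSpace ℝ (Fin r) →L[ℝ] EuclideanSpace ℝ (Fin N × Fin r)) (v : Fin r → ℝ) :
    ∑ t, ∑ ν, (Matrix.vecMul v (trainSlice t U)) ν ^ 2 ≤ ‖U‖ ^ 2 * ∑ ν, v ν ^ 2 := by
  refine le_trans (le_of_eq ?_) (sum_sq_sum_opEntry_mul_le U v)
  rw [Fintype.sum_prod_type]
  simp [Matrix.vecMul, dotProduct, trainSlice, mul_comm]

/-- The tensor with given tensor train cores. -/
noncomputable def trainMultilinear (r : ℕ) [NeZero r] (n : Fin d → ℕ) :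
    MultilinearMap ℝ (TrainCore r n) (TensorSpace n) :=
  (WithLp.linearEquiv 2 ℝ (MultiIndex n → ℝ)).symm.toLinearMap.compMultilinearMap
    (MultilinearMap.pi fun μ => (Matrix.entryLinearMap ℝ ℝ (0 : Fin r) (0 : Fin r)).compMultilinearMap
      ((MultilinearMap.mkPiAlgebraFin ℝ d (Matrix (Fin r) (Fin r) ℝ)).compLinearMap
        fun k => trainSlice (μ k)))

theorem trainMultilinear_apply [NeZero r] {n : Fin d → ℕ} (p : ∀ k, TrainCore r n k)
    (μ : MultiIndex n) :
    trainMultilinear r n p μ = trainProd (fun k t => trainSlice t (p k)) μ 0 0 := by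
  simp [trainMultilinear, trainProd]

theorem norm_trainMultilinear_le [NeZero r] {n : Fin d → ℕ} (p : ∀ k, TrainCore r n k) :
    ‖trainMultilinear r n p‖ ≤ ∏ k, ‖p k‖ := by
  rw [← abs_of_nonneg (norm_nonneg (trainMultilinear r n p)),
    ← abs_of_nonneg (Finset.prod_nonneg fun k _ => norm_nonneg (p k)), ← sq_le_sq,
    EuclideanSpace.norm_sq_eq, ← Finset.prod_pow]
  have h := sum_sq_vecMul_trainProd_le (fun k t => trainSlice t (p k)) (fun k => ‖p k‖ ^ 2)
    (fun _ => sq_nonneg _) (fun k v => sum_sq_vecMul_trainSlice_le (p k) v)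
    (Pi.single (0 : Fin r) 1)
  have h1 : ∑ ν, (Pi.single (0 : Fin r) (1 : ℝ) : Fin r → ℝ) ν ^ 2 = 1 := by
    simp [Pi.single_apply]
  rw [h1, mul_one] at h
  refine le_trans (Finset.sum_le_sum fun μ _ => ?_) h
  rw [trainMultilinear_apply, Real.norm_eq_abs, sq_abs]
  refine le_trans (le_of_eq ?_)
    (Finset.single_le_sum (fun ν _ => sq_nonneg _) (Finset.mem_univ (0 : Fin r)))
  simp

theorem finrank_pi_trainCore_le (r : ℕ) (n : Fin d → ℕ) {N : ℕ} (hN : ∀ i, n i ≤ N) :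
    Module.finrank ℝ (∀ k, TrainCore r n k) ≤ d * N * r ^ 2 := by
  have h : ∀ k, Module.finrank ℝ (TrainCore r n k) = r * (n k * r) := fun k => by
    rw [← LinearMap.toContinuousLinearMap.finrank_eq, Module.finrank_linearMap]
    simp
  rw [Module.finrank_pi_fintype, Finset.sum_congr rfl fun k _ => h k]
  calc ∑ k, r * (n k * r) ≤ ∑ _k : Fin d, r * (N * r) := Finset.sum_le_sum fun k _ =>
        Nat.mul_le_mul_left _ (Nat.mul_le_mul_right _ (hN k))
    _ = d * N * r ^ 2 := by simp; ring

/-- The modes `0, …, j`. -/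
def initialModes (d j : ℕ) : Finset (Fin d) := Finset.univ.filter fun i => (i : ℕ) ≤ j

theorem ite_mem_initialModes_succ {n : Fin (d + 1) → ℕ} (j : ℕ) (t t' : Fin (n 0))
    (μ τ : MultiIndex fun i : Fin d => n i.succ) :
    (fun i => if i ∈ initialModes (d + 1) (j + 1) then (Fin.cons t μ : MultiIndex n) i
      else (Fin.cons t' τ : MultiIndex n) i)
      = (Fin.cons t fun i => if i ∈ initialModes d j then μ i else τ i : MultiIndex n) := by
  ext i
  refine Fin.cases ?_ (fun i => ?_) i <;> simp [initialModes]

theorem ite_mem_initialModes_zero {n : Fin (d + 1) → ℕ} (t t' : Fin (n 0))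
    (μ τ : MultiIndex fun i : Fin d => n i.succ) :
    (fun i => if i ∈ initialModes (d + 1) 0 then (Fin.cons t μ : MultiIndex n) i
      else (Fin.cons t' τ : MultiIndex n) i) = (Fin.cons t τ : MultiIndex n) := by
  ext i
  refine Fin.cases ?_ (fun i => ?_) i <;> simp [initialModes]

/-- The restriction of a tensor to a fixed value of the first mode index. -/
noncomputable def headSlice {n : Fin (d + 1) → ℕ} (x : TensorSpace n) (t : Fin (n 0)) :
    TensorSpace fun i : Fin d => n i.succ :=
  WithLp.toLp 2 fun μ => x (Fin.cons t μ : MultiIndex n)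

theorem sum_norm_sq_headSlice {n : Fin (d + 1) → ℕ} (x : TensorSpace n) :
    ∑ t, ‖headSlice x t‖ ^ 2 = ‖x‖ ^ 2 := by
  simp only [EuclideanSpace.norm_sq_eq, Real.norm_eq_abs, sq_abs]
  rw [Fin.sum_pi_succ]
  rfl

/-- Induction from left to right on a contractive family of `r` tensors. The slices at fixed first
index span at most `r` dimensions. Their coefficients in a padded orthonormal basis `Q` form the
first core, and `Q` is the family for the next step. The coefficient map is a contraction, so
orthonormality of `Q` keeps the cores contractive. -/
theorem exists_train_matrices [NeZero r] {n : Fin (d + 1) → ℕ} (μ₀ : MultiIndex n)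
    (x : Fin r → TensorSpace n) (hx : ∀ c : Fin r → ℝ, ‖∑ ν, c ν • x ν‖ ^ 2 ≤ ∑ ν, c ν ^ 2)
    (hr : ∀ j < d, Module.finrank ℝ (Submodule.span ℝ (Set.range fun νμ : Fin r × MultiIndex n =>
      rowSlice (x νμ.1) (initialModes (d + 1) j) νμ.2)) ≤ r) :
    ∃ W : ∀ k, Fin (n k) → Matrix (Fin r) (Fin r) ℝ,
      (∀ k (v : Fin r → ℝ), ∑ t, ∑ ν, (Matrix.vecMul v (W k t)) ν ^ 2 ≤ ∑ ν, v ν ^ 2) ∧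
      ∀ ν μ, x ν μ = trainProd W μ ν 0 := by
  induction d with
  | zero =>
    -- The last core is a column vector, stored in column `0` of a square matrix.
    let W₀ : Fin (n 0) → Matrix (Fin r) (Fin r) ℝ := fun t => Matrix.of fun ν ν' =>
      if ν' = 0 then x ν (Fin.cons t finZeroElim : MultiIndex n) else 0
    refine ⟨Fin.cons (α := fun k => Fin (n k) → Matrix (Fin r) (Fin r) ℝ) W₀ finZeroElim,
      fun k v => ?_, fun ν μ => ?_⟩
    · obtain rfl : k = 0 := Fin.fin_one_eq_zero k
      refine le_trans (le_of_eq ?_) (hx v)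
      rw [EuclideanSpace.norm_sq_eq, Fin.sum_pi_succ]
      refine Finset.sum_congr rfl fun t _ => ?_
      simp only [Finset.univ_unique, Finset.sum_singleton, Fin.cons_zero]
      rw [Finset.sum_eq_single (0 : Fin r)]
      · simp only [Matrix.vecMul, dotProduct, W₀, Matrix.of_apply, if_true, WithLp.ofLp_sum,
          WithLp.ofLp_smul, Finset.sum_apply, Pi.smul_apply, smul_eq_mul, Real.norm_eq_abs, sq_abs]
        rfl
      · intro ν _ hν
        simp [Matrix.vecMul, dotProduct, W₀, hν]
      · simp
    · rw [← Fin.cons_self_tail μ, trainProd_cons, Subsingleton.elim (Fin.tail μ) finZeroElim]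
      simp [trainProd, W₀]
  | succ d ih =>
    let n' : Fin (d + 1) → ℕ := fun i => n i.succ
    let y : Fin r × Fin (n 0) → TensorSpace n' := fun νt => headSlice (x νt.1) νt.2
    have hV : Module.finrank ℝ (Submodule.span ℝ (Set.range y)) ≤ r := by
      refine le_trans ?_ (hr 0 (Nat.succ_pos d))
      refine finrank_span_range_comp_le ((WithLp.linearEquiv 2 ℝ (MultiIndex n' → ℝ)).symm.toLinearMap
        ∘ₗ LinearMap.funLeft ℝ ℝ fun τ : MultiIndex n' => (Fin.cons (μ₀ 0) τ : MultiIndex n)) _ _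
        (fun νt => (νt.1, (Fin.cons νt.2 (Fin.tail μ₀) : MultiIndex n))) fun νt => ?_
      ext τ
      exact congrArg (x νt.1) (ite_mem_initialModes_zero νt.2 (μ₀ 0) (Fin.tail μ₀) τ).symm
    obtain ⟨Q, hQV, hQx, hQc⟩ := Submodule.exists_padded_orthonormal _ hV
    obtain ⟨W', hW', hQW⟩ := ih (n := n') (Fin.tail μ₀) Q hQc fun j hj => by
      refine le_trans ?_ (hr (j + 1) (Nat.succ_lt_succ hj))
      let L : (MultiIndex n → ℝ) →ₗ[ℝ] (MultiIndex n' → ℝ) :=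
        LinearMap.funLeft ℝ ℝ fun τ => (Fin.cons (μ₀ 0) τ : MultiIndex n)
      refine le_trans (Submodule.finrank_mono (Submodule.span_le.2 ?_))
        (Submodule.finrank_map_le L _)
      rintro _ ⟨⟨ν, μ⟩, rfl⟩
      let R : TensorSpace n' →ₗ[ℝ] (MultiIndex n' → ℝ) :=
        LinearMap.funLeft ℝ ℝ (fun (τ : MultiIndex n') i =>
            if i ∈ initialModes (d + 1) j then μ i else τ i) ∘ₗ
          (WithLp.linearEquiv 2 ℝ (MultiIndex n' → ℝ)).toLinearMap
      -- Each `Q ν` is a combination of slices of the `x κ`, so its row slices lie in the restricted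
      -- span of theirs, and the rank bounds pass to `Q` with the index shifted by one.
      have hle : Submodule.span ℝ (Set.range y) ≤ Submodule.comap R (Submodule.map L
          (Submodule.span ℝ (Set.range fun νμ : Fin r × MultiIndex n =>
            rowSlice (x νμ.1) (initialModes (d + 1 + 1) (j + 1)) νμ.2))) := by
        rw [Submodule.span_le]
        rintro _ ⟨⟨κ, t⟩, rfl⟩
        refine ⟨_, Submodule.subset_span ⟨(κ, (Fin.cons t μ : MultiIndex n)), rfl⟩, ?_⟩
        ext τ
        exact congrArg (x κ) (ite_mem_initialModes_succ j t (μ₀ 0) μ τ)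
      exact hle (hQV ν)
    let W₀ : Fin (n 0) → Matrix (Fin r) (Fin r) ℝ := fun t => Matrix.of fun ν ν' =>
      inner ℝ (Q ν') (y (ν, t))
    refine ⟨Fin.cons (α := fun k => Fin (n k) → Matrix (Fin r) (Fin r) ℝ) W₀ W',
      fun k v => ?_, fun ν μ => ?_⟩
    · refine Fin.cases ?_ (fun k => ?_) k
      · refine le_trans ?_ (hx v)
        rw [← sum_norm_sq_headSlice]
        refine Finset.sum_le_sum fun t _ => ?_
        have hy : headSlice (∑ ν, v ν • x ν) t = ∑ ν, v ν • y (ν, t) := by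
          ext μ
          simp [headSlice, y, Finset.sum_apply]
        rw [hy]
        refine le_trans (le_of_eq ?_) (sum_inner_sq_le_of_norm_sum_smul_le hQc _)
        refine Finset.sum_congr rfl fun ν' _ => ?_
        simp [Matrix.vecMul, dotProduct, W₀, inner_sum, real_inner_smul_right]
      · exact hW' k v
    · rw [← Fin.cons_self_tail μ, trainProd_cons]
      have h1 : x ν (Fin.cons (μ 0) (Fin.tail μ) : MultiIndex n) = y (ν, μ 0) (Fin.tail μ) := rfl
      rw [h1, ← hQx (y (ν, μ 0)) (Submodule.subset_span ⟨_, rfl⟩), Matrix.mul_apply]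
      simp only [WithLp.ofLp_sum, WithLp.ofLp_smul, Finset.sum_apply, Pi.smul_apply, smul_eq_mul]
      exact Finset.sum_congr rfl fun ν' _ => congrArg₂ _ rfl (hQW ν' (Fin.tail μ))

theorem exists_trainMultilinear_eq [NeZero r] {n : Fin (d + 1) → ℕ} (u : TensorSpace n)
    (hu : ‖u‖ ≤ 1) (hr : ∀ j, (matricisation u (ttNode (d + 1) j)).rank ≤ r) :
    ∃ p : ∀ k, TrainCore r n k, ‖p‖ ≤ 1 ∧ trainMultilinear r n p = u := by
  rcases isEmpty_or_nonempty (MultiIndex n) with hemp | ⟨⟨μ₀⟩⟩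
  · exact ⟨0, by simp, by ext μ; exact hemp.elim μ⟩
  -- A family supported at index `0` starts the recursion, so `u` is the `(0, 0)` entry of the
  -- matrix product.
  · let x : Fin r → TensorSpace n := fun ν => if ν = 0 then u else 0
    have hx : ∀ c : Fin r → ℝ, ‖∑ ν, c ν • x ν‖ ^ 2 ≤ ∑ ν, c ν ^ 2 := fun c => by
      have h1 : ∑ ν, c ν • x ν = c 0 • u := by simp [x]
      rw [h1, norm_smul, mul_pow, Real.norm_eq_abs, sq_abs]
      calc c 0 ^ 2 * ‖u‖ ^ 2 ≤ c 0 ^ 2 * 1 :=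
            mul_le_mul_of_nonneg_left (pow_le_one₀ (norm_nonneg _) hu) (sq_nonneg _)
        _ ≤ ∑ ν, c ν ^ 2 := by
            rw [mul_one]
            exact Finset.single_le_sum (f := fun ν => c ν ^ 2) (fun ν _ => sq_nonneg _)
              (Finset.mem_univ _)
    have hxr : ∀ j < d, Module.finrank ℝ (Submodule.span ℝ (Set.range
        fun νμ : Fin r × MultiIndex n =>
          rowSlice (x νμ.1) (initialModes (d + 1) j) νμ.2)) ≤ r := fun j hj => by
      refine le_trans (Submodule.finrank_mono (Submodule.span_le.2 ?_))
        ((finrank_span_rowSlice_le u (ttNode (d + 1) ⟨j, hj⟩)).trans (hr ⟨j, hj⟩))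
      rintro _ ⟨⟨ν, μ⟩, rfl⟩
      by_cases hν : ν = 0
      · simp only [x, hν, if_true]
        exact Submodule.subset_span ⟨μ, rfl⟩
      · simp only [x, hν, if_false]
        exact Submodule.zero_mem _
    obtain ⟨W, hW, hWx⟩ := exists_train_matrices μ₀ x hx hxr
    choose U hU1 hU using fun k => exists_opEntry_eq (α := Fin r) (β := Fin (n k) × Fin r)
      (fun tν ν => W k tν.1 ν tν.2) fun v => by
        have := hW k v
        rw [Fintype.sum_prod_type]
        simpa [Matrix.vecMul, dotProduct, mul_comm] using this
    refine ⟨U, (pi_norm_le_iff_of_nonneg zero_le_one).2 hU1, ?_⟩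
    ext μ
    have hslice : (fun k t => trainSlice t (U k)) = W := by
      ext k t ν ν'
      exact hU k (t, ν') ν
    rw [trainMultilinear_apply, hslice, ← hWx]
    simp [x]

end TensorTrain

/-! ### Union bound and the restricted isometry constant -/

section RestrictedIsometry

variable {d m : ℕ} {n : Fin d → ℕ} {ι : Type} {node : ι → Finset (Fin d)} {r : ι → ℕ}

theorem Matrix.rank_smul_le {X Y : Type*} [Fintype Y] [DecidableEq Y] (c : ℝ)
    (M : Matrix X Y ℝ) : (c • M).rank ≤ M.rank := by
  have h : c • M = M * (c • (1 : Matrix Y Y ℝ)) := by rw [Matrix.mul_smul, Matrix.mul_one]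
  rw [h]
  exact Matrix.rank_mul_le_left _ _

theorem rank_matricisation_smul_le (c : ℝ) (u : TensorSpace n) (α : Finset (Fin d)) :
    (matricisation (c • u) α).rank ≤ (matricisation u α).rank :=
  Matrix.rank_smul_le c (matricisation u α)

theorem eq_zero_of_rank_matricisation_eq_zero {u : TensorSpace n} {α : Finset (Fin d)}
    (h : (matricisation u α).rank = 0) : u = 0 := by
  rw [Matrix.rank_eq_finrank_span_cols, Submodule.finrank_eq_zero, Submodule.span_eq_bot] at h
  ext μ
  have := congrFun (h _ ⟨fun i => μ i, rfl⟩) fun i => μ i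
  simpa [matricisation, Matrix.col] using this

theorem tric_le_of_rankManifold_subset {A : TensorSpace n →ₗ[ℝ] EuclideanSpace ℝ (Fin m)} {δ : ℝ}
    (hδ : 0 ≤ δ) (h : rankManifold node n r ⊆ {0}) : tric node r A ≤ δ := by
  refine (tric_isLeast node r A).2 ⟨hδ, fun u hu => ?_⟩
  obtain rfl : u = 0 := h hu
  simp

theorem tric_le_of_normalised {A : TensorSpace n →ₗ[ℝ] EuclideanSpace ℝ (Fin m)} {δ : ℝ}
    (hδ : 0 ≤ δ) (h : ∀ u ∈ rankManifold node n r,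
      |‖A (‖u‖⁻¹ • u)‖ ^ 2 - ‖‖u‖⁻¹ • u‖ ^ 2| ≤ δ) : tric node r A ≤ δ := by
  refine (tric_isLeast node r A).2 ⟨hδ, fun u hu => ?_⟩
  by_cases hu0 : u = 0
  · simp [hu0]
  · have hpos : 0 < ‖u‖ := norm_pos_iff.2 hu0
    have h1 := h u hu
    rw [map_smul, norm_smul, norm_smul, norm_inv, norm_norm, mul_pow, mul_pow, ← mul_sub, abs_mul,
      abs_of_pos (by positivity), inv_pow, inv_mul_le_iff₀ (by positivity)] at h1
    have h2 := abs_le.1 h1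
    constructor <;> linarith

theorem norm_inv_norm_smul_le {H : Type*} [NormedAddCommGroup H] [NormedSpace ℝ H] (u : H) :
    ‖‖u‖⁻¹ • u‖ ≤ 1 := by
  rw [norm_smul, norm_inv, norm_norm]
  exact inv_mul_le_one

/-- With `L = log d`, one has `4 ≤ exp (2 D L)` and `1 + 8 K ≤ 8 d + 9 ≤ d ^ 5`. The exponent is
then at most `12 D L - x / 64`, and any constant from `13 * 64 = 832` on suffices in place of
`1000`. -/
theorem four_mul_sq_mul_exp_le {K D d : ℕ} (hK : K ≤ d + 1) (hd : 2 ≤ d) (hD : 1 ≤ D)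
    {x ε : ℝ} (hε0 : 0 < ε) (hε1 : ε < 1)
    (hx : 1000 * max (D * Real.log d) (Real.log ε⁻¹) ≤ x) :
    4 * ((1 + 8 * K : ℝ) ^ D) ^ 2 * Real.exp (-(x / 64)) ≤ ε := by
  have hd' : (2 : ℝ) ≤ d := by exact_mod_cast hd
  have hD' : (1 : ℝ) ≤ D := by exact_mod_cast hD
  have hK' : (K : ℝ) ≤ d + 1 := by exact_mod_cast hK
  have hL : Real.log 2 ≤ Real.log d := Real.log_le_log two_pos hd'
  have hL2 : 0 < Real.log 2 := Real.log_pos one_lt_two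
  set L := Real.log d with hLdef
  have hdL : Real.exp L = d := Real.exp_log (by linarith)
  have hDL : L ≤ D * L := le_mul_of_one_le_left (by linarith) hD'
  have h4 : (4 : ℝ) ≤ Real.exp (2 * (D * L)) := by
    have : (4 : ℝ) = Real.exp (2 * Real.log 2) := by
      rw [two_mul, Real.exp_add, Real.exp_log two_pos]; norm_num
    rw [this, Real.exp_le_exp]
    linarith
  have hbase : (1 + 8 * K : ℝ) ≤ Real.exp (5 * L) := by
    rw [show (5 : ℝ) * L = (5 : ℕ) * L by norm_num, Real.exp_nat_mul, hdL]
    have h16 : (16 : ℝ) ≤ d ^ 4 := by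
      calc (16 : ℝ) = 2 ^ 4 := by norm_num
        _ ≤ d ^ 4 := by gcongr
    nlinarith
  have hpow : ((1 + 8 * K : ℝ) ^ D) ^ 2 ≤ Real.exp (10 * (D * L)) := by
    calc ((1 + 8 * K : ℝ) ^ D) ^ 2 ≤ (Real.exp (5 * L) ^ D) ^ 2 := by gcongr
      _ = Real.exp (10 * (D * L)) := by
        rw [← Real.exp_nat_mul, ← Real.exp_nat_mul]
        congr 1
        push_cast
        ring
  have hεL : 0 ≤ Real.log ε⁻¹ := Real.log_nonneg ((one_le_inv₀ hε0).2 hε1.le)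
  have hm1 := le_max_left (D * L) (Real.log ε⁻¹)
  have hm2 := le_max_right (D * L) (Real.log ε⁻¹)
  calc 4 * ((1 + 8 * K : ℝ) ^ D) ^ 2 * Real.exp (-(x / 64))
      ≤ Real.exp (2 * (D * L)) * Real.exp (10 * (D * L)) * Real.exp (-(x / 64)) := by gcongr
    _ = Real.exp (2 * (D * L) + 10 * (D * L) - x / 64) := by
        rw [← Real.exp_add, ← Real.exp_add]; ring_nf
    _ ≤ Real.exp (-Real.log ε⁻¹) := by
        rw [Real.exp_le_exp]
        linarith
    _ = ε := by rw [Real.log_inv, neg_neg, Real.exp_log hε0]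

variable {Ω : Type*} [MeasurableSpace Ω] {P : Measure Ω} [IsProbabilityMeasure P]

/-- The restricted isometry property for a set of tensors whose normalisations are parametrised by
a multilinear map of norm at most `1` on the unit ball of a `D`-dimensional space. -/
theorem IsGaussianMeasurement.tric_le_of_multilinear {a : Fin m × MultiIndex n → Ω → ℝ}
    (ha : IsGaussianMeasurement P a) {κ : Type} [Fintype κ] [Nonempty κ] {E : κ → Type}
    [∀ k, NormedAddCommGroup (E k)] [∀ k, NormedSpace ℝ (E k)] [∀ k, FiniteDimensional ℝ (E k)]
    (T : MultilinearMap ℝ E (TensorSpace n)) (hT : ∀ p, ‖T p‖ ≤ ∏ k, ‖p k‖)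
    (hex : ∀ u ∈ rankManifold node n r, ∃ p, ‖p‖ ≤ 1 ∧ T p = ‖u‖⁻¹ • u)
    {D : ℕ} (hD : Module.finrank ℝ (∀ k, E k) ≤ D) (hD1 : 1 ≤ D) (hκ : Fintype.card κ ≤ d + 1)
    (hd : 2 ≤ d) {δ ε : ℝ} (hδ0 : 0 < δ) (hδ1 : δ < 1) (hε0 : 0 < ε) (hε1 : ε < 1)
    (hm : 1000 * δ ^ (-2 : ℤ) * max (D * Real.log d) (Real.log ε⁻¹) ≤ m) :
    ENNReal.ofReal (1 - ε) ≤ P {ω | tric node r (measurementMap fun k => a k ω) ≤ δ} := by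
  have hεL : 0 < Real.log ε⁻¹ := Real.log_pos ((one_lt_inv₀ hε0).2 hε1)
  have hm' : 1000 * max (D * Real.log d) (Real.log ε⁻¹) ≤ m * δ ^ 2 := by
    have : δ ^ (-2 : ℤ) = (δ ^ 2)⁻¹ := by rw [zpow_neg]; norm_cast
    rw [this, mul_right_comm, ← div_eq_mul_inv, div_le_iff₀ (by positivity)] at hm
    exact hm
  -- Since `log ε⁻¹ > 0`, the bound on `m` excludes `m = 0`.
  have hm0 : 0 < m := by
    rcases Nat.eq_zero_or_pos m with rfl | h
    · have := le_max_right (D * Real.log d) (Real.log ε⁻¹)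
      simp only [Nat.cast_zero, zero_mul] at hm'
      linarith
    · exact h
  have hTb : ∀ p, ‖T p‖ ≤ 1 * ∏ k, ‖p k‖ := fun p => (hT p).trans_eq (one_mul _).symm
  obtain ⟨Z, hZcard, hZ⟩ := (T.mkContinuous 1 hTb).exists_finset_isometry_test
    (T.mkContinuous_norm_le zero_le_one hTb)
  let B : TensorSpace n → Set Ω := fun z =>
    {ω | δ / 2 * ‖z‖ ^ 2 < |‖measurementMap (fun k => a k ω) z‖ ^ 2 - ‖z‖ ^ 2|}
  have hB : P.real (⋃ z ∈ Z, B z) ≤ ε := by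
    calc P.real (⋃ z ∈ Z, B z) ≤ ∑ z ∈ Z, P.real (B z) := measureReal_biUnion_finset_le Z B
      _ ≤ ∑ _z ∈ Z, 2 * Real.exp (-(m * δ ^ 2 / 64)) := Finset.sum_le_sum fun z _ => by
          refine (ha.measureReal_norm_sq_deviation_le hm0 (by linarith) (by linarith) z).trans
            (le_of_eq ?_)
          ring_nf
      _ = Z.card * (2 * Real.exp (-(m * δ ^ 2 / 64))) := by rw [Finset.sum_const, nsmul_eq_mul]
      _ ≤ 2 * ((1 + 8 * Fintype.card κ : ℝ) ^ D) ^ 2 * (2 * Real.exp (-(m * δ ^ 2 / 64))) := by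
          gcongr
          refine hZcard.trans ?_
          gcongr
          linarith [(Nat.cast_nonneg (Fintype.card κ) : (0 : ℝ) ≤ _)]
      _ = 4 * ((1 + 8 * Fintype.card κ : ℝ) ^ D) ^ 2 * Real.exp (-(m * δ ^ 2 / 64)) := by ring
      _ ≤ ε := four_mul_sq_mul_exp_le hκ hd hD1 hε0 hε1 hm'
  -- Covering the whole space by the good event and the bad ones needs only subadditivity of `P`,
  -- not measurability of the good event.
  have hcover : Set.univ ⊆
      {ω | tric node r (measurementMap fun k => a k ω) ≤ δ} ∪ ⋃ z ∈ Z, B z := by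
    intro ω _
    by_cases hω : ω ∈ ⋃ z ∈ Z, B z
    · exact Or.inr hω
    · left
      simp only [Set.mem_iUnion, exists_prop, not_exists, not_and, B, Set.mem_ofPred_eq,
        not_lt] at hω
      refine tric_le_of_normalised hδ0.le fun u hu => ?_
      obtain ⟨p, hp, hpu⟩ := hex u hu
      have h := hZ _ (LinearMap.toContinuousLinearMap (measurementMap fun k => a k ω)) (δ / 2)
        (by positivity) hω p hp
      rw [mul_div_cancel₀ _ two_ne_zero] at h
      rw [← hpu]
      exact h
  have h1 : (1 : ℝ≥0∞) ≤ P {ω | tric node r (measurementMap fun k => a k ω) ≤ δ}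
      + ENNReal.ofReal ε := by
    calc (1 : ℝ≥0∞) = P Set.univ := measure_univ.symm
      _ ≤ _ := (measure_mono hcover).trans (measure_union_le _ _)
      _ ≤ _ := by
        gcongr
        rw [← ofReal_measureReal (measure_ne_top P _)]
        exact ENNReal.ofReal_le_ofReal hB
  rw [ENNReal.ofReal_sub _ hε0.le, ENNReal.ofReal_one]
  exact tsub_le_iff_right.2 h1

theorem le_measure_tric_le_of_rankManifold_subset {a : Fin m × MultiIndex n → Ω → ℝ} {δ ε : ℝ}
    (hδ : 0 ≤ δ) (hε : 0 ≤ ε) (h : rankManifold node n r ⊆ {0}) :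
    ENNReal.ofReal (1 - ε) ≤ P {ω | tric node r (measurementMap fun k => a k ω) ≤ δ} := by
  have huniv : {ω | tric node r (measurementMap fun k => a k ω) ≤ δ} = Set.univ :=
    Set.eq_univ_of_forall fun ω => tric_le_of_rankManifold_subset hδ h
  rw [huniv, measure_univ, ENNReal.ofReal_le_one]
  linarith

theorem rankManifold_subset_zero [Fintype ι] [Nonempty ι] (hd : 0 < d)
    (h : Finset.univ.sup r = 0 ∨ Finset.univ.sup n = 0) : rankManifold node n r ⊆ {0} := by
  intro u hu
  rcases h with h | h
  · obtain ⟨j⟩ := ‹Nonempty ι›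
    refine eq_zero_of_rank_matricisation_eq_zero (α := node j) ((hu j).trans ?_)
    exact Nat.le_zero.1 ((Finset.le_sup (f := r) (Finset.mem_univ j)).trans_eq h)
  · refine PiLp.ext fun μ => ?_
    have h0 : n ⟨0, hd⟩ ≤ 0 := (Finset.le_sup (f := n) (Finset.mem_univ _)).trans_eq h
    exact absurd (μ ⟨0, hd⟩).isLt (by omega)

end RestrictedIsometry

theorem theorem2 :
    ∃ C : ℝ, 0 < C ∧
      ∀ (d : ℕ), 2 ≤ d → ∀ (n : Fin d → ℕ) (m : ℕ) (δ ε : ℝ),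
        0 < δ → δ < 1 → 0 < ε → ε < 1 →
        ∀ (Ω : Type*) [MeasurableSpace Ω] (P : Measure Ω) [IsProbabilityMeasure P]
          (a : Fin m × MultiIndex n → Ω → ℝ), IsGaussianMeasurement P a →
          (∀ r : Fin d → ℕ,
            C * δ ^ (-2 : ℤ) *
                max ((((Finset.univ.sup r : ℕ) : ℝ) ^ d
                    + (d : ℝ) * ((Finset.univ.sup n : ℕ) : ℝ) * ((Finset.univ.sup r : ℕ) : ℝ))
                  * Real.log (d : ℝ)) (Real.log ε⁻¹) ≤ (m : ℝ) →
            ENNReal.ofReal (1 - ε) ≤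
              P {ω | tric (hosvdNode d) r (measurementMap fun k => a k ω) ≤ δ}) ∧
          (∀ r : Fin (d - 1) → ℕ,
            C * δ ^ (-2 : ℤ) *
                max (((d : ℝ) * ((Finset.univ.sup n : ℕ) : ℝ)
                    * ((Finset.univ.sup r : ℕ) : ℝ) ^ 2)
                  * Real.log ((d : ℝ) * ((Finset.univ.sup r : ℕ) : ℝ))) (Real.log ε⁻¹)
                ≤ (m : ℝ) →
            ENNReal.ofReal (1 - ε) ≤
              P {ω | tric (ttNode d) r (measurementMap fun k => a k ω) ≤ δ}) := by
  refine ⟨1000, by norm_num, ?_⟩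
  intro d hd n m δ ε hδ0 hδ1 hε0 hε1 Ω _ P _ a ha
  have hn : ∀ i, n i ≤ Finset.univ.sup n := fun i => Finset.le_sup (Finset.mem_univ i)
  obtain ⟨d, rfl⟩ : ∃ e, d = e + 1 := ⟨d - 1, by omega⟩
  refine ⟨fun r hm => ?_, fun r hm => ?_⟩
  -- In these cases only the zero tensor can occur. Excluding them gives `D ≥ 1`, needed to absorb
  -- the factor `4`, and for trains an index `0` in `Fin r`.
  · by_cases hdeg : Finset.univ.sup r = 0 ∨ Finset.univ.sup n = 0
    · exact le_measure_tric_le_of_rankManifold_subset hδ0.le hε0.le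
        (rankManifold_subset_zero d.succ_pos hdeg)
    rw [not_or] at hdeg
    refine ha.tric_le_of_multilinear (tuckerMultilinear (Finset.univ.sup r) n)
      norm_tuckerMultilinear_le (fun u hu => ?_) (finrank_pi_tuckerFactor_le _ n hn) ?_
      (by simp) hd hδ0 hδ1 hε0 hε1 ?_
    · refine exists_tuckerMultilinear_eq _ (norm_inv_norm_smul_le u) fun i => ?_
      exact (rank_matricisation_smul_le _ _ _).trans
        ((hu i).le.trans (Finset.le_sup (Finset.mem_univ i)))
    · have := Nat.pow_pos (n := d + 1) (Nat.pos_of_ne_zero hdeg.1)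
      omega
    · push_cast at hm ⊢
      exact hm
  · have : Nonempty (Fin (d + 1 - 1)) := ⟨⟨0, by omega⟩⟩
    by_cases hdeg : Finset.univ.sup r = 0 ∨ Finset.univ.sup n = 0
    · exact le_measure_tric_le_of_rankManifold_subset hδ0.le hε0.le
        (rankManifold_subset_zero d.succ_pos hdeg)
    rw [not_or] at hdeg
    have : NeZero (Finset.univ.sup r) := ⟨hdeg.1⟩
    refine ha.tric_le_of_multilinear (trainMultilinear (Finset.univ.sup r) n)
      norm_trainMultilinear_le (fun u hu => ?_) (finrank_pi_trainCore_le _ n hn) ?_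
      (by simp) hd hδ0 hδ1 hε0 hε1 ?_
    · refine exists_trainMultilinear_eq _ (norm_inv_norm_smul_le u) fun j => ?_
      exact (rank_matricisation_smul_le _ _ _).trans
        ((hu j).le.trans (Finset.le_sup (Finset.mem_univ j)))
    · exact Nat.succ_le_of_lt (Nat.mul_pos (Nat.mul_pos d.succ_pos (Nat.pos_of_ne_zero hdeg.2))
        (Nat.pow_pos (Nat.pos_of_ne_zero hdeg.1)))
    · refine le_trans ?_ hm
      have hr1 : (1 : ℝ) ≤ (Finset.univ.sup r : ℕ) := by
        exact_mod_cast Nat.pos_of_ne_zero hdeg.1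
      have hd0 : (0 : ℝ) < (d + 1 : ℕ) := by positivity
      -- The argument needs only `log d` here; the assumed `log (d r)` is larger because `r ≥ 1`.
      have hlog : Real.log (d + 1 : ℕ) ≤ Real.log ((d + 1 : ℕ) * (Finset.univ.sup r : ℕ)) :=
        Real.log_le_log hd0 (le_mul_of_one_le_right hd0.le hr1)
      refine mul_le_mul_of_nonneg_left (max_le_max ?_ le_rfl) (by positivity)
      push_cast at hlog ⊢
      exact mul_le_mul_of_nonneg_left hlog (by positivity)
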